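/- Model. Networks are finite simple undirected graphs (not assumed connected); $n$ denotes the number of vertices. Fix a function $b:\mathbb N\to\mathbb N$ with $b(n)=O(\log n)$; the vertices of an $n$-vertex graph carry pairwise distinct identifiers, which are natural numbers written on at most $b(n)$ bits. A certificate assignment gives a finite bit string to every vertex. The view at distance $d$ of a vertex $v$ consists of the vertices at distance at most $d$ from $v$, their identifiers and certificates, and the edges between these vertices except those between two vertices at distance exactly $d$ from $v$. A graph property has a local certification of size $s$ with verification radius $d$ if there is a verification algorithm (a map from views at distance $d$ to $\{\text{accept},\text{reject}\}$) such that, for every $n$-vertex graph $G$ and every assignment of identifiers: (i) if $G$ has the property, then there is a certificate assignment with certificates of at most $s(n)$ bits for which every vertex accepts; (ii) if $G$ does not have the property, then for every certificate assignment at least one vertex rejects. A graph is $P_m$-free if it does not contain the path $P_m$ on $m$ vertices as an induced subgraph. Theorem. Let $k\ge 2$. (1) There is a constant $c>0$ (depending only on $k$ and $b$) such that, for every $0<\varepsilon<1$, the property of being $P_{3k-1}$-free has a local certification with verification radius $k$ and certificates of at most $\frac{c}{\varepsilon}\, n^{1+\varepsilon}\log^2 n$ bits. (2) The property of being $P_{3k-1}$-free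 has a local certification with verification radius $k$ and certificates of $O(n\log^3 n)$ bits. -/

import Mathlib

open Filter Asymptotics

namespace LocalCert

/-- `G` is `H`-free: `G` does not contain `H` as an induced subgraph. -/
def InducedFree {W V : Type} (H : SimpleGraph W) (G : SimpleGraph V) : Prop :=
  ¬ H.IsIndContained G

/-- What a vertex may see of the network. As identifiers are unique, the vertices of the view are
represented by their identifiers. -/
@[ext]
structure View where
  /-- the identifier of the vertex whose view this is -/
  center : ℕ
  /-- the visible vertices: the pairs (identifier, certificate) -/
  labels : Set (ℕ × List Bool)
  /-- the visible edges, as a (symmetric) relation between identifiers -/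
  adj : ℕ → ℕ → Prop

/-- The view at distance `d` of the vertex `v` in the graph `G` with identifiers `ident` and
certificates `cert`: the vertices at distance at most `d` from `v`, with their identifiers and
certificates, and the edges between them except those between two vertices at distance exactly `d`.
The distance is `⊤` between different connected components. -/
def viewAt {V : Type} (G : SimpleGraph V) (ident : V → ℕ) (cert : V → List Bool)
    (d : ℕ) (v : V) : View where
  center := ident v
  labels := {p | ∃ u, G.edist v u ≤ d ∧ p = (ident u, cert u)}
  adj a b := ∃ u w, ident u = a ∧ ident w = b ∧ G.Adj u w ∧
    G.edist v u ≤ d ∧ G.edist v w ≤ d ∧ ¬ (G.edist v u = d ∧ G.edist v w = d)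

/-- Unique identifiers, each a natural number written on at most `bits` bits. -/
def ValidIdent {V : Type} (bits : ℕ) (ident : V → ℕ) : Prop :=
  Function.Injective ident ∧ ∀ v, ident v < 2 ^ bits

/-- In the networks whose identifiers have at most `idBits n` bits, where `n` is the number of
vertices, the graph property `P` has a local certification of size `s` (in bits) with
verification radius `d`. The verification algorithm `verify` maps views to accept / reject;
its only input is the view. -/
def HasLocalCertification (idBits : ℕ → ℕ) (d : ℕ) (s : ℕ → ℝ)
    (P : ∀ V : Type, SimpleGraph V → Prop) : Prop :=
  ∃ verify : View → Bool,
    ∀ (V : Type) [Fintype V] (G : SimpleGraph V) (ident : V → ℕ),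
      ValidIdent (idBits (Fintype.card V)) ident →
        (P V G → ∃ cert : V → List Bool,
          (∀ v, ((cert v).length : ℝ) ≤ s (Fintype.card V)) ∧
          ∀ v, verify (viewAt G ident cert d v) = true) ∧
        (¬ P V G → ∀ cert : V → List Bool,
          ∃ v, verify (viewAt G ident cert d v) = false)

end LocalCert

namespace LocalCert

/-! Give every vertex the level `Nat.log 2` of its degree. For each level `l` let the height of a
vertex be its distance, truncated at `k`, to the vertices of level at least `l`. All certificates
share one table of levels, heights, names of link components and tail lengths. The neighbourhood
lists are distributed so that the closed neighbourhood of any `x` stores the list of every vertex of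
level at most that of `x` (`exists_speaks`, a union bound). Each vertex then stores O(n log² n)
edges, each costing O(log n) bits.

For soundness, each accepting vertex with an incident edge has the view of a vertex in some honest,
path-free instance. Instances of different vertices may differ, but they share the table along each
connected component. Two ends of a link edge at the level of `r` both see a common certificate
listing the neighbours of `r`, so this list is the same throughout a link component, and it is the
true one at `r`. Hence the instance of a vertex `y` is correct about every vertex that `y` dominates
(`Twinned.adj_image_iff`).

An induced path on `3k - 1` vertices is either dominated by one of its vertices, whose instance then
contains a forbidden path, or splits in two dominated parts (`Layering.dominates_or_splitsAt`). In
the second case the table certifies a tail at least as long as the second part. The instance correct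
about the first part must contain such a tail; heights and component names keep it apart from the
first part, so gluing again gives a forbidden path (`Twinned.not_exists_isIndPath`). The bound in
(1) follows from the n log³ n bound because `ε log n ≤ n ^ ε`. -/

variable {V W : Type}

/-! ### Binary encoding of finitely supported tables -/

/-- Self-delimiting code of a list of bits. -/
def encBits : List Bool → List Bool
  | [] => [false]
  | b :: l => true :: b :: encBits l

theorem encBits_append_inj : ∀ {l l' s s' : List Bool},
    encBits l ++ s = encBits l' ++ s' → l = l' ∧ s = s'
  | [], [], s, s', h => by simpa [encBits] using h
  | [], b :: l', s, s', h => by simp [encBits] at h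
  | b :: l, [], s, s', h => by simp [encBits] at h
  | b :: l, b' :: l', s, s', h => by
    simp only [encBits, List.cons_append, List.cons.injEq, true_and] at h
    obtain ⟨rfl, h⟩ := h
    obtain ⟨rfl, hs⟩ := encBits_append_inj h
    exact ⟨rfl, hs⟩

theorem encBits_length (l : List Bool) : (encBits l).length = 2 * l.length + 1 := by
  induction l with
  | nil => rfl
  | cons b l ih => simp only [encBits, List.length_cons, ih]; ring

/-- Self-delimiting code of a natural number. -/
def encNat (n : ℕ) : List Bool := encBits n.bits

theorem bits_injective : Function.Injective Nat.bits := by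
  intro a b h
  have : ∀ n : ℕ, Nat.ofDigits 2 (n.bits.map fun b => cond b 1 0) = n := fun n => by
    rw [← Nat.digits_two_eq_bits, Nat.ofDigits_digits]
  rw [← this a, ← this b, h]

theorem encNat_append_inj {a b : ℕ} {s s' : List Bool} (h : encNat a ++ s = encNat b ++ s') :
    a = b ∧ s = s' :=
  (encBits_append_inj h).imp_left fun h => bits_injective h

theorem encNat_length {n w : ℕ} (h : n < 2 ^ w) : (encNat n).length ≤ 2 * w + 1 := by
  have : n.bits.length ≤ w := by
    rw [Nat.size_eq_bits_len]; exact Nat.size_le.2 h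
  rw [encNat, encBits_length]; omega

/-- Code of a list of quadruples of natural numbers. -/
def encList : List (ℕ × ℕ × ℕ × ℕ) → List Bool
  | [] => []
  | (a, b, c, d) :: l => encNat a ++ (encNat b ++ (encNat c ++ (encNat d ++ encList l)))

theorem encNat_append_ne_nil (a : ℕ) (s : List Bool) : encNat a ++ s ≠ [] := by
  unfold encNat
  cases a.bits <;> simp [encBits]

theorem encList_injective : Function.Injective encList := by
  intro l
  induction l with
  | nil =>
    rintro (_ | ⟨⟨a, b, c, d⟩, l'⟩) h
    · rfl
    · exact absurd h.symm (encNat_append_ne_nil _ _)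
  | cons x l ih =>
    obtain ⟨a, b, c, d⟩ := x
    rintro (_ | ⟨⟨a', b', c', d'⟩, l'⟩) h
    · exact absurd h (encNat_append_ne_nil _ _)
    · simp only [encList] at h
      obtain ⟨e1, h1⟩ := encNat_append_inj h
      obtain ⟨e2, h2⟩ := encNat_append_inj h1
      obtain ⟨e3, h3⟩ := encNat_append_inj h2
      obtain ⟨e4, h4⟩ := encNat_append_inj h3
      rw [e1, e2, e3, e4, ih h4]

theorem encList_length {w : ℕ} (l : List (ℕ × ℕ × ℕ × ℕ))
    (h : ∀ x ∈ l, x.1 < 2 ^ w ∧ x.2.1 < 2 ^ w ∧ x.2.2.1 < 2 ^ w ∧ x.2.2.2 < 2 ^ w) :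
    (encList l).length ≤ l.length * (4 * (2 * w + 1)) := by
  induction l with
  | nil => simp [encList]
  | cons x l ih =>
    obtain ⟨a, b, c, d⟩ := x
    have hx := h (a, b, c, d) (by simp)
    have ih := ih fun y hy => h y (by simp [hy])
    have h1 := encNat_length hx.1
    have h2 := encNat_length hx.2.1
    have h3 := encNat_length hx.2.2.1
    have h4 := encNat_length hx.2.2.2
    simp only [encList, List.length_append, List.length_cons, Nat.add_mul, one_mul]
    simp only at h1 h2 h3 h4
    omega

open Classical in
/-- The ternary function on `ℕ` whose nonzero values are listed by a bit string. -/
noncomputable def decode (s : List Bool) (a b c : ℕ) : ℕ :=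
  if h : ∃ v, ∃ l, encList l = s ∧ (a, b, c, v) ∈ l then h.choose else 0

theorem exists_decode_eq (f : ℕ → ℕ → ℕ → ℕ) (S : Finset (ℕ × ℕ × ℕ)) (w : ℕ)
    (hS : ∀ a b c, f a b c ≠ 0 → (a, b, c) ∈ S)
    (hw : ∀ x ∈ S, x.1 < 2 ^ w ∧ x.2.1 < 2 ^ w ∧ x.2.2 < 2 ^ w ∧ f x.1 x.2.1 x.2.2 < 2 ^ w) :
    ∃ s : List Bool, decode s = f ∧ s.length ≤ S.card * (4 * (2 * w + 1)) := by
  classical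
  let l := S.toList.map fun x => (x.1, x.2.1, x.2.2, f x.1 x.2.1 x.2.2)
  have hl : ∀ a b c v, (a, b, c, v) ∈ l ↔ (a, b, c) ∈ S ∧ v = f a b c := by
    intro a b c v
    simp only [l, List.mem_map, Finset.mem_toList, Prod.mk.injEq, Prod.exists]
    constructor
    · rintro ⟨a', b', c', h, rfl, rfl, rfl, rfl⟩; exact ⟨h, rfl⟩
    · rintro ⟨h, rfl⟩; exact ⟨a, b, c, h, rfl, rfl, rfl, rfl⟩
  refine ⟨encList l, ?_, ?_⟩
  · funext a b c
    unfold decode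
    split_ifs with h
    · obtain ⟨l', h1, h2⟩ := h.choose_spec
      rw [encList_injective h1, hl] at h2
      exact h2.2
    · by_contra hne
      exact h ⟨f a b c, l, rfl, (hl _ _ _ _).2 ⟨hS _ _ _ (Ne.symm hne), rfl⟩⟩
  · refine (encList_length (w := w) l ?_).trans (by simp [l])
    rintro ⟨a, b, c, v⟩ hx
    obtain ⟨h, rfl⟩ := (hl _ _ _ _).1 hx
    exact hw _ h

/-! ### Induced paths, heights and link components -/

/-- The vertices `p 0, …, p (m - 1)` induce, in this order, a path of `G`. -/
def IsIndPath (G : SimpleGraph V) (m : ℕ) (p : ℕ → V) : Prop :=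
  ∀ i < m, ∀ j < m, (p i = p j → i = j) ∧ (G.Adj (p i) (p j) ↔ i + 1 = j ∨ j + 1 = i)

theorem inducedFree_pathGraph_iff {G : SimpleGraph V} {m : ℕ} (hm : 0 < m) :
    InducedFree (SimpleGraph.pathGraph m) G ↔ ¬ ∃ p, IsIndPath G m p := by
  refine not_congr ⟨fun ⟨f⟩ => ?_, fun ⟨p, hp⟩ => ?_⟩
  · refine ⟨fun i => if h : i < m then f ⟨i, h⟩ else f ⟨0, hm⟩, fun i hi j hj => ?_⟩
    simp only [hi, hj, dif_pos]
    refine ⟨fun h => ?_, ?_⟩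
    · simpa using f.injective h
    · rw [f.map_adj_iff, SimpleGraph.pathGraph_adj]
  · exact ⟨⟨⟨fun i => p i, fun i j h => Fin.ext ((hp i i.2 j j.2).1 h)⟩, fun {i j} => by
      rw [SimpleGraph.pathGraph_adj]; exact (hp i i.2 j j.2).2⟩⟩

theorem IsIndPath.reverse {G : SimpleGraph V} {m : ℕ} {p : ℕ → V} (h : IsIndPath G m p) :
    IsIndPath G m fun i => p (m - 1 - i) := by
  intro i hi j hj
  have := h (m - 1 - i) (by omega) (m - 1 - j) (by omega)
  refine ⟨fun e => ?_, ?_⟩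
  · have := this.1 e; omega
  · rw [this.2]; omega

/-- The edges with one end at height at most `k - 2` and the other at height at most `k - 1`. -/
def linkGraph (G : SimpleGraph V) (k : ℕ) (φ : V → ℕ) : SimpleGraph V where
  Adj u v := G.Adj u v ∧ φ u < k ∧ φ v < k ∧ (φ u + 2 ≤ k ∨ φ v + 2 ≤ k)
  symm := ⟨fun _ _ h => ⟨h.1.symm, h.2.2.1, h.2.1, h.2.2.2.symm⟩⟩
  loopless := ⟨fun _ h => h.1.ne rfl⟩

/-- For each `l`, `φ l` is the distance, truncated at `k`, to the vertices of level at least `l`,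
and `cl l` names the components of the corresponding link graph by the identifier of a leader,
which can be reached along decreasing values of `t l`. -/
structure Layering (G : SimpleGraph V) (ident : V → ℕ) (k : ℕ) (lv : V → ℕ)
    (φ cl t : ℕ → V → ℕ) : Prop where
  le : ∀ l v, φ l v ≤ k
  zero_iff : ∀ l v, φ l v = 0 ↔ l ≤ lv v
  lip : ∀ l u v, G.Adj u v → φ l u ≤ φ l v + 1
  down : ∀ l v, 0 < φ l v → φ l v < k → ∃ u, G.Adj v u ∧ φ l u + 1 = φ l v
  cl_eq : ∀ l u v, (linkGraph G k (φ l)).Adj u v → cl l u = cl l v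
  root : ∀ l v, φ l v < k →
    cl l v = ident v ∨ ∃ u, (linkGraph G k (φ l)).Adj v u ∧ t l u < t l v

namespace Layering

variable {G : SimpleGraph V} {ident : V → ℕ} {k : ℕ} {lv : V → ℕ} {φ cl t : ℕ → V → ℕ}

/-- Following neighbours with decreasing `t l` must end, and it can only end at a vertex bearing the
announced name. This turns conditions on single edges into a statement on whole components. -/
theorem exists_leader (L : Layering G ident k lv φ cl t) (l : ℕ) (v : V) (hv : φ l v < k) :
    ∃ w, (linkGraph G k (φ l)).Reachable v w ∧ ident w = cl l v := by
  induction h : t l v using Nat.strong_induction_on generalizing v with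
  | _ n ih =>
    subst h
    rcases L.root l v hv with h | ⟨u, hu, ht⟩
    · exact ⟨v, .refl _, h.symm⟩
    · obtain ⟨w, hw, hc⟩ := ih _ ht u hu.2.2.1 rfl
      exact ⟨w, hu.reachable.trans hw, hc.trans (L.cl_eq l v u hu).symm⟩

theorem reachable_of_cl_eq (L : Layering G ident k lv φ cl t) (hid : Function.Injective ident)
    {l : ℕ} {u v : V} (hu : φ l u < k) (hv : φ l v < k) (h : cl l u = cl l v) :
    (linkGraph G k (φ l)).Reachable u v := by
  obtain ⟨w, hw, hc⟩ := L.exists_leader l u hu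
  obtain ⟨w', hw', hc'⟩ := L.exists_leader l v hv
  have : w = w' := hid (by rw [hc, hc', h])
  exact hw.trans (this ▸ hw'.symm)

theorem exists_near (L : Layering G ident k lv φ cl t) (l : ℕ) (v : V) (hv : φ l v < k) :
    ∃ x, l ≤ lv x ∧ ∃ w : G.Walk v x, w.length ≤ φ l v := by
  induction h : φ l v generalizing v with
  | zero => exact ⟨v, (L.zero_iff l v).1 h, .nil, by simp⟩
  | succ n ih =>
    obtain ⟨u, hu, he⟩ := L.down l v (by omega) hv
    obtain ⟨x, hx, w, hw⟩ := ih u (by omega) (by omega)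
    exact ⟨x, hx, .cons hu w, by simpa using hw⟩

variable {m : ℕ} {p : ℕ → V}

theorem φ_le_add (L : Layering G ident k lv φ cl t) (hp : IsIndPath G m p) (l i e : ℕ)
    (h : i + e < m) : φ l (p (i + e)) ≤ φ l (p i) + e ∧ φ l (p i) ≤ φ l (p (i + e)) + e := by
  induction e with
  | zero => simp
  | succ e ih =>
    have ih := ih (by omega)
    have ha : G.Adj (p (i + e)) (p (i + (e + 1))) := (hp _ (by omega) _ h).2.2 (.inl (by omega))
    have h1 := L.lip l _ _ ha
    have h2 := L.lip l _ _ ha.symm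
    omega

/-- Two vertices of level at least `l` at distance at most `2k - 2` on a path are linked. -/
theorem reachable_of_close (L : Layering G ident k lv φ cl t) (hk : 0 < k)
    (hp : IsIndPath G m p) {l i j : ℕ} (hj : j < m) (hi : i < m) (h1 : i ≤ j + (2 * k - 2))
    (h2 : j ≤ i + (2 * k - 2)) (h0 : φ l (p i) = 0) (h0' : φ l (p j) = 0) :
    (linkGraph G k (φ l)).Reachable (p i) (p j) := by
  wlog hij : i ≤ j generalizing i j
  · exact (this hi hj h2 h1 h0' h0 (by omega)).symm
  obtain ⟨d, rfl⟩ := Nat.exists_eq_add_of_le hij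
  have key : ∀ e ≤ d, (linkGraph G k (φ l)).Reachable (p i) (p (i + e)) := by
    intro e
    induction e with
    | zero => intro _; exact .refl _
    | succ e ih =>
      intro he
      refine (ih (by omega)).trans (SimpleGraph.Adj.reachable ?_)
      -- The height at `p (i + e)` is at most `min e (d - e)`. As `d ≤ 2k - 2`, this is below `k`,
      -- and only the midpoint can reach `k - 1`, so every edge has an end of height at most `k -
      -- 2`.
      have a1 := (L.φ_le_add hp l i e (by omega)).1
      have a2 := (L.φ_le_add hp l i (e + 1) (by omega)).1
      have b1 := (L.φ_le_add hp l (i + e) (d - e) (by omega)).2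
      have b2 := (L.φ_le_add hp l (i + (e + 1)) (d - (e + 1)) (by omega)).2
      rw [show i + e + (d - e) = i + d by omega] at b1
      rw [show i + (e + 1) + (d - (e + 1)) = i + d by omega] at b2
      refine ⟨(hp _ (by omega) _ (by omega)).2.2 (.inl (by omega)), ?_, ?_, ?_⟩ <;> omega
  exact key d le_rfl

end Layering

open Classical in
/-- The height restricted to the component of `c` in the link graph, and `k` elsewhere. -/
noncomputable def compHeight (G : SimpleGraph V) (k : ℕ) (φ : V → ℕ) (c u : V) : ℕ :=
  if (linkGraph G k φ).Reachable u c then φ u else k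

/-- An edge at a vertex of height at most `k - 2` is a link edge, so a component can only be left
from height at least `k - 1`. The value `k` outside therefore creates no jump. -/
theorem Layering.compHeight_lip {G : SimpleGraph V} {ident : V → ℕ} {k : ℕ} {lv : V → ℕ}
    {φ cl t : ℕ → V → ℕ} (L : Layering G ident k lv φ cl t) (l : ℕ) (c : V) {u v : V}
    (h : G.Adj u v) : compHeight G k (φ l) c u ≤ compHeight G k (φ l) c v + 1 := by
  have hlip := L.lip l u v h
  have hk := L.le l u
  unfold compHeight
  split_ifs with hu hv hv
  · exact hlip
  · omega
  · by_contra hlt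
    refine hu (SimpleGraph.Reachable.trans (SimpleGraph.Adj.reachable ⟨h, ?_, ?_, ?_⟩) hv) <;> omega
  · omega

/-! ### Splitting an induced path on at most `3k - 1` vertices -/

/-- Discrete intermediate value theorem. -/
theorem exists_eq_between {m : ℕ} {f : ℕ → ℕ}
    (hf : ∀ r, r + 1 < m → f r ≤ f (r + 1) + 1 ∧ f (r + 1) ≤ f r + 1) {i j s : ℕ} (hi : i < m)
    (hj : j < m) (h1 : f i ≤ s) (h2 : s ≤ f j) :
    ∃ r < m, min i j ≤ r ∧ r ≤ max i j ∧ f r = s := by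
  rcases le_total i j with h | h
  · obtain ⟨d, rfl⟩ := Nat.exists_eq_add_of_le h
    induction d with
    | zero => exact ⟨i, hi, by simp, by simp, by simp at h2; omega⟩
    | succ d ih =>
      by_cases hs : s ≤ f (i + d)
      · obtain ⟨r, hr⟩ := ih (by omega) hs (by omega)
        exact ⟨r, hr.1, by omega, by omega, hr.2.2.2⟩
      · have := hf (i + d) (by omega)
        rw [← add_assoc] at *
        exact ⟨i + d + 1, by omega, by omega, by omega, by omega⟩
  · obtain ⟨d, rfl⟩ := Nat.exists_eq_add_of_le h
    induction d with
    | zero => exact ⟨j, hj, by simp, by simp, by simp at h1; omega⟩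
    | succ d ih =>
      by_cases hs : f (j + d) ≤ s
      · obtain ⟨r, hr⟩ := ih (by omega) hs (by omega)
        exact ⟨r, hr.1, by omega, by omega, hr.2.2.2⟩
      · have := hf (j + d) (by omega)
        rw [← add_assoc] at *
        exact ⟨j + d + 1, by omega, by omega, by omega, by omega⟩

/-- If every value in `[1, k - 1]` is taken at least twice and `0` is taken, then at least
`2k - 1` indices have a value below `k`. -/
theorem card_lt_of_twice {m k : ℕ} {f : ℕ → ℕ} (hk : 0 < k) (h0 : ∃ r < m, f r = 0)
    (h : ∀ s, 1 ≤ s → s < k → ∃ a < m, ∃ b < m, a ≠ b ∧ f a = s ∧ f b = s) :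
    2 * k - 1 ≤ ((Finset.range m).filter fun r => f r < k).card := by
  classical
  have hfib : ∀ s < k, (if s = 0 then 1 else 2) ≤
      (((Finset.range m).filter fun r => f r < k).filter fun r => f r = s).card := by
    intro s hs
    split_ifs with h0s
    · obtain ⟨r, hr, hr0⟩ := h0
      exact Finset.card_pos.2 ⟨r, by simp [hr, hr0, hk, h0s]⟩
    · obtain ⟨a, ha, b, hb, hab, hfa, hfb⟩ := h s (by omega) hs
      rw [← Finset.card_pair hab]
      refine Finset.card_le_card fun x hx => ?_
      rcases Finset.mem_insert.1 hx with rfl | hx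
      · simp [ha, hfa, hs]
      · rw [Finset.mem_singleton.1 hx]; simp [hb, hfb, hs]
  have hmaps : ∀ x ∈ (Finset.range m).filter (fun r => f r < k), f x ∈ Finset.range k := by simp
  rw [Finset.card_eq_sum_card_fiberwise hmaps]
  refine le_trans ?_ (Finset.sum_le_sum fun s hs => hfib s (Finset.mem_range.1 hs))
  obtain ⟨k, rfl⟩ : ∃ k', k = k' + 1 := ⟨k - 1, by omega⟩
  rw [Finset.sum_range_succ']
  simp
  omega

namespace Layering

variable {G : SimpleGraph V} {ident : V → ℕ} {k : ℕ} {lv : V → ℕ} {φ cl t : ℕ → V → ℕ}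
  {m : ℕ} {p : ℕ → V}

/-- The vertex `y` has at least the level of `v`, and is linked to it at the level of `v`. -/
def Dominates (G : SimpleGraph V) (k : ℕ) (lv : V → ℕ) (φ : ℕ → V → ℕ) (y v : V) : Prop :=
  lv v ≤ lv y ∧ (linkGraph G k (φ (lv v))).Reachable v y

/-- The path `p` splits at `p a` into two parts, each dominated by one of its vertices; on the
second part the height at level `l` stays below that of `p a`, and no vertex of the first part
of at most this height is linked to `p a`. -/
def SplitsAt (G : SimpleGraph V) (k : ℕ) (lv : V → ℕ) (φ : ℕ → V → ℕ) (m : ℕ) (p : ℕ → V)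
    (l a : ℕ) : Prop :=
  a < m ∧ φ l (p a) < k ∧
    (∃ y ≤ a, ∀ r ≤ a, Dominates G k lv φ (p y) (p r)) ∧
    (∃ z < m, ∀ r, a ≤ r → r < m → Dominates G k lv φ (p z) (p r)) ∧
    (∀ r, a < r → r < m → φ l (p r) < φ l (p a)) ∧
    ∀ r < a, φ l (p r) ≤ φ l (p a) → ¬ (linkGraph G k (φ l)).Reachable (p r) (p a)

theorem compHeight_lip_path (L : Layering G ident k lv φ cl t) (hp : IsIndPath G m p)
    (l : ℕ) (c : V) (r : ℕ) (hr : r + 1 < m) :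
    compHeight G k (φ l) c (p r) ≤ compHeight G k (φ l) c (p (r + 1)) + 1 ∧
      compHeight G k (φ l) c (p (r + 1)) ≤ compHeight G k (φ l) c (p r) + 1 := by
  have ha : G.Adj (p r) (p (r + 1)) := (hp _ (by omega) _ hr).2.2 (.inl rfl)
  exact ⟨L.compHeight_lip l c ha, L.compHeight_lip l c ha.symm⟩

/-- A height taken only once separates the path: before `a` the component height exceeds `s`, after
`a` it is smaller. Each part is dominated by its vertex of highest level, since the relevant
vertices are close enough to be linked, or have level below `l`, where `hmin` applies. -/
theorem splitsAt_of_unique (L : Layering G ident k lv φ cl t) (hk : 2 ≤ k) (hm : m ≤ 3 * k - 1)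
    (hp : IsIndPath G m p) {l i j s a : ℕ}
    (hmin : ∀ l' < l, ∀ r < m, ∀ r' < m, φ l' (p r) = 0 → φ l' (p r') = 0 →
      (linkGraph G k (φ l')).Reachable (p r) (p r'))
    (hji : j < i) (hi : i < m) (hi0 : φ l (p i) = 0) (hj0 : φ l (p j) = 0)
    (hij : ¬ (linkGraph G k (φ l)).Reachable (p i) (p j)) (hs1 : 1 ≤ s) (hsk : s < k) (ha : a < m)
    (hsa : compHeight G k (φ l) (p i) (p a) = s)
    (huniq : ∀ r < m, compHeight G k (φ l) (p i) (p r) = s → r = a) :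
    SplitsAt G k lv φ m p l a := by
  set ψ : ℕ → ℕ := fun r => compHeight G k (φ l) (p i) (p r) with hψ
  have hlip : ∀ r, r + 1 < m → ψ r ≤ ψ (r + 1) + 1 ∧ ψ (r + 1) ≤ ψ r + 1 :=
    fun r hr => L.compHeight_lip_path hp l (p i) r hr
  have hψi : ψ i = 0 := by simp [hψ, compHeight, hi0]
  have hψj : ψ j = k := by
    simp only [hψ, compHeight]
    rw [if_neg fun h => hij h.symm]
  have hψa : ψ a = s := hsa
  have hlt : ∀ r, ψ r < k → (linkGraph G k (φ l)).Reachable (p r) (p i) ∧ φ l (p r) = ψ r := by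
    intro r hr
    simp only [hψ, compHeight] at hr ⊢
    split_ifs at hr ⊢ with h
    · exact ⟨h, rfl⟩
    · omega
  have hreach : ∀ r, (linkGraph G k (φ l)).Reachable (p r) (p i) → ψ r = φ l (p r) := by
    intro r h
    simp [hψ, compHeight, h]
  obtain ⟨r, hr, hr1, hr2, hrs⟩ := exists_eq_between hlip hi (hji.trans hi) (s := s)
    (by omega) (by omega)
  obtain rfl := huniq r hr hrs
  have hja : j < r := by
    rcases Nat.lt_or_ge j r with h | h
    · exact h
    · have : r = j := by omega
      subst this; omega
  have hai : r < i := by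
    rcases Nat.lt_or_ge r i with h | h
    · exact h
    · have : r = i := by omega
      subst this; omega
  have hgt : ∀ r', r < r' → r' < m → ψ r' < s := by
    intro r' h1 h2
    by_contra h3
    obtain ⟨q, hq, hq1, hq2, hqs⟩ := exists_eq_between hlip hi h2 (s := s) (by omega) (by omega)
    have := huniq q hq hqs
    omega
  have hle : ∀ r', r' < r → s < ψ r' := by
    intro r' h1
    by_contra h3
    obtain ⟨q, hq, hq1, hq2, hqs⟩ := exists_eq_between hlip (i := r') (j := j) (s := s)
      (by omega) (by omega) (by omega) (by omega)
    have := huniq q hq hqs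
    omega
  obtain ⟨har, hφr⟩ := hlt r (by omega)
  -- Within fewer than `k` steps of `p j` the path is still in the component of `p j`, whereas `p r`
  -- is in that of `p i`.
  have hjk : j + k ≤ r := by
    by_contra hcon
    obtain ⟨d, rfl⟩ := Nat.exists_eq_add_of_le hja.le
    have hd := L.φ_le_add hp l j d ha
    have : (linkGraph G k (φ l)).Reachable (p j) (p (j + d)) := by
      have key : ∀ e, e ≤ d → compHeight G k (φ l) (p j) (p (j + e)) ≤ e := by
        intro e
        induction e with
        | zero => intro _; simp [compHeight, hj0]
        | succ e ih =>
          intro he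
          have h1 := ih (by omega)
          have h2 := (L.compHeight_lip_path hp l (p j) (j + e) (by omega)).2
          rw [← add_assoc]
          omega
      have h1 := key d le_rfl
      unfold compHeight at h1
      split_ifs at h1 with h2
      · exact h2.symm
      · omega
    exact hij (this.trans har).symm
  refine ⟨ha, by omega, ?_, ?_, ?_, ?_⟩
  · obtain ⟨y, hy, hmax⟩ := Finset.exists_max_image (Finset.range (r + 1)) (fun i => lv (p i))
      ⟨0, by simp⟩
    simp only [Finset.mem_range] at hy hmax
    refine ⟨y, by omega, fun q hq => ⟨hmax q (by omega), ?_⟩⟩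
    have hqy := hmax q (by omega)
    have h0 : φ (lv (p q)) (p q) = 0 := (L.zero_iff _ _).2 le_rfl
    have h0' : φ (lv (p q)) (p y) = 0 := (L.zero_iff _ _).2 hqy
    rcases Nat.lt_or_ge (lv (p q)) l with hl | hl
    · exact hmin _ hl q (by omega) y (by omega) h0 h0'
    -- Otherwise `p e` would be linked to `p i` and have component height `0`, impossible up to `r`.
    -- Since `i ≤ 3k - 2`, all such `e` are below `k`, hence close to each other.
    · have far : ∀ e ≤ r, l ≤ lv (p e) → e + (2 * k - 2) < i := by
        intro e he hle'
        have he0 := (L.zero_iff l (p e)).2 hle'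
        by_contra hc
        have h1 := hreach e (L.reachable_of_close (by omega) hp hi (by omega) (by omega) (by omega)
          he0 hi0)
        rcases Nat.lt_or_ge e r with h2 | h2
        · have := hle e h2; omega
        · have : e = r := by omega
          subst this; omega
      have h1 := far q hq hl
      have h2 := far y (by omega) (by omega)
      exact L.reachable_of_close (by omega) hp (by omega) (by omega) (by omega) (by omega) h0 h0'
  · obtain ⟨z, hz, hmax⟩ := Finset.exists_max_image (Finset.Ico r m) (fun i => lv (p i))
      ⟨r, by simp [ha]⟩
    simp only [Finset.mem_Ico] at hz hmax
    refine ⟨z, by omega, fun q hq hqm => ⟨hmax q ⟨hq, hqm⟩, ?_⟩⟩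
    -- Here `r ≥ k`, so the indices from `r` to `m - 1` differ by at most `2k - 2`.
    exact L.reachable_of_close (by omega) hp (by omega) (by omega) (by omega) (by omega)
      ((L.zero_iff _ _).2 le_rfl) ((L.zero_iff _ _).2 (hmax q ⟨hq, hqm⟩))
  · intro q h1 h2
    have h3 := hgt q h1 h2
    have := (hlt q (by omega)).2
    omega
  · intro q h1 h2 h3
    have := hreach q (h3.trans har)
    have := hle q h1
    omega

/-- Otherwise both components would take each height in `[1, k - 1]` twice. Being disjoint, they
would occupy `2(2k - 1) > 3k - 1` vertices of the path. -/
theorem exists_unique_height (L : Layering G ident k lv φ cl t) (hk : 2 ≤ k) (hm : m ≤ 3 * k - 1)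
    (hp : IsIndPath G m p) {l i j : ℕ} (hi : i < m) (hj : j < m)
    (hi0 : φ l (p i) = 0) (hj0 : φ l (p j) = 0)
    (hij : ¬ (linkGraph G k (φ l)).Reachable (p i) (p j)) :
    ∃ i' < m, ∃ j' < m, φ l (p i') = 0 ∧ φ l (p j') = 0 ∧
      ¬ (linkGraph G k (φ l)).Reachable (p i') (p j') ∧
      ∃ s, 1 ≤ s ∧ s < k ∧ ∃ a < m, compHeight G k (φ l) (p i') (p a) = s ∧
        ∀ r < m, compHeight G k (φ l) (p i') (p r) = s → r = a := by
  by_contra hcon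
  push Not at hcon
  have twice : ∀ i < m, ∀ j < m, φ l (p i) = 0 → φ l (p j) = 0 →
      ¬ (linkGraph G k (φ l)).Reachable (p i) (p j) → 2 * k - 1 ≤
        ((Finset.range m).filter fun r => compHeight G k (φ l) (p i) (p r) < k).card := by
    intro i hi j hj hi0 hj0 hij
    refine card_lt_of_twice (f := fun r => compHeight G k (φ l) (p i) (p r)) (by omega)
      ⟨i, hi, by simp [compHeight, hi0]⟩ fun s hs1 hsk => ?_
    have hj' : compHeight G k (φ l) (p i) (p j) = k := by
      unfold compHeight; rw [if_neg fun h => hij h.symm]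
    obtain ⟨a, ha, -, -, hs⟩ := exists_eq_between
      (f := fun r => compHeight G k (φ l) (p i) (p r)) (s := s)
      (fun r hr => L.compHeight_lip_path hp l (p i) r hr) hi hj
      (by simp [compHeight, hi0]) (by simp only [hj']; omega)
    obtain ⟨r, hr, hrs, hra⟩ := hcon i hi j hj hi0 hj0 hij s hs1 hsk a ha hs
    exact ⟨a, ha, r, hr, Ne.symm hra, hs, hrs⟩
  have h1 := twice i hi j hj hi0 hj0 hij
  have h2 := twice j hj i hi hj0 hi0 fun h => hij h.symm
  have hdisj : Disjoint
      ((Finset.range m).filter fun r => compHeight G k (φ l) (p i) (p r) < k)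
      ((Finset.range m).filter fun r => compHeight G k (φ l) (p j) (p r) < k) := by
    refine Finset.disjoint_left.2 fun r hr hr' => ?_
    have e1 := (Finset.mem_filter.1 hr).2
    have e2 := (Finset.mem_filter.1 hr').2
    unfold compHeight at e1 e2
    split_ifs at e1 with c1
    · split_ifs at e2 with c2
      · exact hij (c1.symm.trans c2)
      · omega
    · omega
  have h3 := Finset.card_le_card (Finset.union_subset
    (Finset.filter_subset (fun r => compHeight G k (φ l) (p i) (p r) < k) (Finset.range m))
    (Finset.filter_subset (fun r => compHeight G k (φ l) (p j) (p r) < k) (Finset.range m)))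
  rw [Finset.card_union_of_disjoint hdisj, Finset.card_range] at h3
  omega

/-- An induced path on at most `3k - 1` vertices is dominated by one of its vertices, or splits,
possibly after reversal. -/
theorem dominates_or_splitsAt (L : Layering G ident k lv φ cl t) (hk : 2 ≤ k) (hm0 : 0 < m)
    (hm : m ≤ 3 * k - 1) (hp : IsIndPath G m p) :
    (∃ y < m, ∀ r < m, Dominates G k lv φ (p y) (p r)) ∨
      ∃ p', IsIndPath G m p' ∧ ∃ l a, SplitsAt G k lv φ m p' l a := by
  classical
  by_cases hex : ∃ l, ∃ i < m, ∃ j < m, φ l (p i) = 0 ∧ φ l (p j) = 0 ∧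
      ¬ (linkGraph G k (φ l)).Reachable (p i) (p j)
  · right
    -- The least level with unlinked vertices is taken, so that all links needed at lower levels are
    -- available.
    obtain ⟨i, hi, j, hj, hi0, hj0, hij⟩ := Nat.find_spec hex
    set l := Nat.find hex with hl
    have hmin : ∀ l' < l, ∀ r < m, ∀ r' < m, φ l' (p r) = 0 → φ l' (p r') = 0 →
        (linkGraph G k (φ l')).Reachable (p r) (p r') := by
      intro l' hl' r hr r' hr' h0 h0'
      by_contra hc
      exact Nat.find_min hex hl' ⟨r, hr, r', hr', h0, h0', hc⟩
    obtain ⟨i, hi, j, hj, hi0, hj0, hij, s, hs1, hsk, a, ha, hsa, huniq⟩ :=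
      L.exists_unique_height hk hm hp hi hj hi0 hj0 hij
    rcases lt_trichotomy j i with h | h | h
    · exact ⟨p, hp, l, a, L.splitsAt_of_unique hk hm hp hmin h hi hi0 hj0 hij hs1 hsk ha hsa huniq⟩
    · subst h; exact absurd (.refl _) hij
    · have e : ∀ r, r < m → m - 1 - (m - 1 - r) = r := by omega
      refine ⟨_, hp.reverse, l, m - 1 - a, L.splitsAt_of_unique (i := m - 1 - i) (j := m - 1 - j)
        (s := s) hk hm hp.reverse ?_ (by omega) (by omega) ?_ ?_ ?_ hs1 hsk (by omega) ?_ ?_⟩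
      · exact fun l' hl' r hr r' hr' => hmin l' hl' _ (by omega) _ (by omega)
      · simpa only [e i hi] using hi0
      · simpa only [e j hj] using hj0
      · simpa only [e i hi, e j hj] using hij
      · simpa only [e i hi, e a ha] using hsa
      · intro r hr h
        simp only [e i hi] at h
        have := huniq _ (by omega) h
        omega
  · left
    push Not at hex
    obtain ⟨y, hy, hmax⟩ := Finset.exists_max_image (Finset.range m) (fun i => lv (p i))
      ⟨0, by simp [hm0]⟩
    simp only [Finset.mem_range] at hy hmax
    exact ⟨y, hy, fun r hr => ⟨hmax r hr, hex _ r hr y hy ((L.zero_iff _ _).2 le_rfl)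
      ((L.zero_iff _ _).2 (hmax r hr))⟩⟩

end Layering

/-! ### Honest instances and soundness -/

/-- An induced path with `q + 1` vertices starting at `v`, all others being lower than `v`. -/
def IsTail (G : SimpleGraph V) (φ : V → ℕ) (v : V) (q : ℕ) (p : ℕ → V) : Prop :=
  p 0 = v ∧ IsIndPath G (q + 1) p ∧ ∀ i, 0 < i → i ≤ q → φ (p i) < φ v

/-- A graph without induced path on `3k - 1` vertices, with honest certificates. The decoded
certificate of a vertex has a part common to all vertices, with tags `0` to `4`, and a list of the
neighbourhoods of some vertices, with tags `5` and `6`. -/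
structure HonestInstance (k : ℕ) where
  /-- the vertices -/
  V : Type
  /-- the network -/
  G : SimpleGraph V
  /-- the identifiers -/
  ident : V → ℕ
  /-- the certificates -/
  cert : V → List Bool
  /-- the levels of the vertices -/
  lv : V → ℕ
  /-- the truncated distances to the vertices of a given level -/
  φ : ℕ → V → ℕ
  /-- the leaders of the link components -/
  cl : ℕ → V → ℕ
  /-- the distances to the leaders -/
  t : ℕ → V → ℕ
  /-- the lengths of the longest tails -/
  tail : ℕ → V → ℕ
  /-- the first vertex stores the neighbourhood of the second one -/
  speaks : V → V → Prop
  inj : Function.Injective ident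
  lay : Layering G ident k lv φ cl t
  hit : ∀ x r, lv r ≤ lv x → ∃ h, (h = x ∨ G.Adj x h) ∧ speaks h r
  exists_tail : ∀ l v, ∃ p, IsTail G (φ l) v (tail l v) p
  le_tail : ∀ l v q p, q < 3 * k → IsTail G (φ l) v q p → q ≤ tail l v
  common : ∀ h h' c, c < 5 → decode (cert h) c = decode (cert h') c
  decode_φ : ∀ h r l, decode (cert h) 0 (ident r) l = k - φ l r
  decode_cl : ∀ h r l, decode (cert h) 1 (ident r) l = cl l r
  decode_t : ∀ h r l, decode (cert h) 2 (ident r) l = t l r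
  decode_tail : ∀ h r l, decode (cert h) 3 (ident r) l = tail l r
  decode_lv : ∀ h r, decode (cert h) 4 (ident r) 0 = lv r + 1
  exists_ident : ∀ h a, decode (cert h) 4 a 0 ≠ 0 → ∃ r, ident r = a
  decode_speaks : ∀ h r, decode (cert h) 6 (ident r) 0 ≠ 0 ↔ speaks h r
  decode_nbr : ∀ h r b, speaks h r →
    (decode (cert h) 5 (ident r) b ≠ 0 ↔ ∃ q, G.Adj r q ∧ ident q = b)
  free : ¬ ∃ p, IsIndPath G (3 * k - 1) p

theorem HonestInstance.rows_eq {k : ℕ} (I J : HonestInstance k) {r h : I.V} {s h' : J.V}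
    (hid : I.ident r = J.ident s)
    (hc : ∀ c < 5, decode (I.cert h) c = decode (J.cert h') c) :
    I.lv r = J.lv s ∧ ∀ l, I.φ l r = J.φ l s ∧ I.cl l r = J.cl l s ∧ I.t l r = J.t l s ∧
      I.tail l r = J.tail l s := by
  refine ⟨?_, fun l => ⟨?_, ?_, ?_, ?_⟩⟩
  · have h1 := I.decode_lv h r
    have h2 := J.decode_lv h' s
    rw [hc 4 (by omega), hid, h2] at h1
    omega
  · have h1 := I.decode_φ h r l
    have h2 := J.decode_φ h' s l
    rw [hc 0 (by omega), hid, h2] at h1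
    have := I.lay.le l r
    have := J.lay.le l s
    omega
  · rw [← I.decode_cl h, ← J.decode_cl h', hc 1 (by omega), hid]
  · rw [← I.decode_t h, ← J.decode_t h', hc 2 (by omega), hid]
  · rw [← I.decode_tail h, ← J.decode_tail h', hc 3 (by omega), hid]

/-- The vertex `u'` of an honest instance looks like the vertex `u` of a network. -/
structure IsTwin {k : ℕ} (G : SimpleGraph V) (ident : V → ℕ) (cert : V → List Bool) (u : V)
    (I : HonestInstance k) (u' : I.V) : Prop where
  ident_eq : I.ident u' = ident u
  cert_eq : I.cert u' = cert u
  adj : ∀ v, G.Adj u v → ∃ v', I.G.Adj u' v' ∧ I.ident v' = ident v ∧ I.cert v' = cert v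
  adj' : ∀ v', I.G.Adj u' v' → ∃ v, G.Adj u v ∧ I.ident v' = ident v ∧ I.cert v' = cert v
  near : ∀ v (w : G.Walk u v), w.length ≤ k → ∃ v', I.cert v' = cert v

/-- A network in which every vertex has a twin in an honest instance. -/
structure Twinned (k : ℕ) (G : SimpleGraph V) (ident : V → ℕ) (cert : V → List Bool) where
  /-- the honest instance -/
  I : V → HonestInstance k
  /-- the twin -/
  twin : ∀ u, (I u).V
  isTwin : ∀ u, IsTwin G ident cert u (I u) (twin u)
  inj : Function.Injective ident

namespace Twinned

variable {k : ℕ} {G : SimpleGraph V} {ident : V → ℕ} {cert : V → List Bool}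
  (T : Twinned k G ident cert)

/-- The level of a vertex according to its twin. -/
def lv (u : V) : ℕ := (T.I u).lv (T.twin u)

/-- The height of a vertex according to its twin. -/
def φ (l : ℕ) (u : V) : ℕ := (T.I u).φ l (T.twin u)

/-- The leader of a vertex according to its twin. -/
def cl (l : ℕ) (u : V) : ℕ := (T.I u).cl l (T.twin u)

/-- The distance to the leader of a vertex according to its twin. -/
def t (l : ℕ) (u : V) : ℕ := (T.I u).t l (T.twin u)

/-- The length of the longest tail from a vertex according to its twin. -/
def tail (l : ℕ) (u : V) : ℕ := (T.I u).tail l (T.twin u)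

include T in
-- The certificates of two adjacent vertices occur together in one honest instance, where the tables
-- agree; this propagates along walks.
theorem common {u v : V} (h : G.Reachable u v) (c : ℕ) (hc : c < 5) :
    decode (cert u) c = decode (cert v) c := by
  obtain ⟨w⟩ := h
  induction w with
  | nil => rfl
  | @cons u v _ h _ ih =>
    obtain ⟨v', -, -, h2⟩ := (T.isTwin u).adj v h
    rw [← ih, ← h2, ← (T.isTwin u).cert_eq]
    exact (T.I u).common _ _ c hc

/-- A vertex of the instance of `u` representing the vertex `v`. -/
structure IsImage (u v : V) (r : (T.I u).V) : Prop where
  ident_eq : (T.I u).ident r = ident v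
  lv_eq : (T.I u).lv r = T.lv v
  φ_eq : ∀ l, (T.I u).φ l r = T.φ l v
  cl_eq : ∀ l, (T.I u).cl l r = T.cl l v
  t_eq : ∀ l, (T.I u).t l r = T.t l v
  tail_eq : ∀ l, (T.I u).tail l r = T.tail l v

theorem isImage_of_ident_eq {u v : V} (h : G.Reachable u v) {r : (T.I u).V}
    (hr : (T.I u).ident r = ident v) : T.IsImage u v r := by
  obtain ⟨h1, h2⟩ := (T.I u).rows_eq (T.I v) (h := T.twin u) (s := T.twin v) (h' := T.twin v)
    (hr.trans (T.isTwin v).ident_eq.symm) fun c hc => by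
      rw [(T.isTwin u).cert_eq, (T.isTwin v).cert_eq, T.common h c hc]
  exact ⟨hr, h1, fun l => (h2 l).1, fun l => (h2 l).2.1, fun l => (h2 l).2.2.1,
    fun l => (h2 l).2.2.2⟩

theorem decode_lv {u v : V} (h : G.Reachable u v) :
    decode (cert u) 4 (ident v) 0 = T.lv v + 1 := by
  rw [T.common h 4 (by omega), ← (T.isTwin v).cert_eq, ← (T.isTwin v).ident_eq]
  exact (T.I v).decode_lv _ _

theorem exists_isImage {u v : V} (h : G.Reachable u v) : ∃ r, T.IsImage u v r := by
  have h1 := T.decode_lv h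
  rw [← (T.isTwin u).cert_eq] at h1
  obtain ⟨r, hr⟩ := (T.I u).exists_ident (T.twin u) (ident v) (by omega)
  exact ⟨r, T.isImage_of_ident_eq h hr⟩

theorem exists_image_adj {u v : V} (h : G.Adj u v) :
    ∃ r, (T.I u).G.Adj (T.twin u) r ∧ T.IsImage u v r := by
  obtain ⟨r, h1, h2, -⟩ := (T.isTwin u).adj v h
  exact ⟨r, h1, T.isImage_of_ident_eq h.reachable h2⟩

theorem exists_adj_image {u : V} {r : (T.I u).V} (h : (T.I u).G.Adj (T.twin u) r) :
    ∃ v, G.Adj u v ∧ T.IsImage u v r := by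
  obtain ⟨v, h1, h2, -⟩ := (T.isTwin u).adj' r h
  exact ⟨v, h1, T.isImage_of_ident_eq h1.reachable h2⟩

/-- Every condition of `Layering` concerns a vertex and its neighbours only, so it passes from the
twin to the network although the instances vary. -/
theorem layering : Layering G ident k T.lv T.φ T.cl T.t where
  le l v := (T.I v).lay.le l _
  zero_iff l v := (T.I v).lay.zero_iff l _
  lip l u v h := by
    obtain ⟨r, h1, h2⟩ := T.exists_image_adj h
    rw [← h2.φ_eq]
    exact (T.I u).lay.lip l _ _ h1
  down l v h0 hk := by
    obtain ⟨r, h1, h2⟩ := (T.I v).lay.down l _ h0 hk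
    obtain ⟨u, h3, h4⟩ := T.exists_adj_image h1
    exact ⟨u, h3, by rw [← h4.φ_eq]; exact h2⟩
  cl_eq l u v h := by
    obtain ⟨r, h1, h2⟩ := T.exists_image_adj h.1
    rw [← h2.cl_eq]
    refine (T.I u).lay.cl_eq l _ _ ⟨h1, h.2.1, ?_, ?_⟩
    · rw [h2.φ_eq]; exact h.2.2.1
    · rw [h2.φ_eq]; exact h.2.2.2
  root l v h := by
    rcases (T.I v).lay.root l _ h with h1 | ⟨r, h1, h2⟩
    · exact .inl (h1.trans (T.isTwin v).ident_eq)
    · obtain ⟨u, h3, h4⟩ := T.exists_adj_image h1.1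
      refine .inr ⟨u, ⟨h3, h, ?_, ?_⟩, ?_⟩
      · rw [← h4.φ_eq]; exact h1.2.2.1
      · rw [← h4.φ_eq]; exact h1.2.2.2
      · rw [← h4.t_eq]; exact h2

theorem exists_speaker {x r : V} (h : G.Reachable x r) (hlv : T.lv r ≤ T.lv x) :
    ∃ h, (h = x ∨ G.Adj x h) ∧ decode (cert h) 6 (ident r) 0 ≠ 0 := by
  obtain ⟨r', hr'⟩ := T.exists_isImage h
  obtain ⟨h', h1, h2⟩ := (T.I x).hit (T.twin x) r' (by rw [hr'.lv_eq]; exact hlv)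
  rw [← (T.I x).decode_speaks, hr'.ident_eq] at h2
  rcases h1 with rfl | h1
  · exact ⟨x, .inl rfl, by rwa [← (T.isTwin x).cert_eq]⟩
  · obtain ⟨v, h3, -, h4⟩ := (T.isTwin x).adj' h' h1
    exact ⟨v, .inr h3, by rwa [← h4]⟩

/-- Some certificate in the view of `u` contains the neighbourhood of `r`, with a neighbour of
identifier `b`. -/
def Says (_T : Twinned k G ident cert) (u r : V) (b : ℕ) : Prop :=
  ∃ h, (∃ w : G.Walk u h, w.length ≤ k) ∧
    decode (cert h) 6 (ident r) 0 ≠ 0 ∧ decode (cert h) 5 (ident r) b ≠ 0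

theorem says_iff_image {u r h : V} {r' : (T.I u).V}
    (hr' : T.IsImage u r r') (hh : ∃ w : G.Walk u h, w.length ≤ k)
    (hs : decode (cert h) 6 (ident r) 0 ≠ 0) (b : ℕ) :
    decode (cert h) 5 (ident r) b ≠ 0 ↔ ∃ q, (T.I u).G.Adj r' q ∧ (T.I u).ident q = b := by
  obtain ⟨w, hw⟩ := hh
  obtain ⟨h', hc⟩ := (T.isTwin u).near h w hw
  rw [← hc, ← hr'.ident_eq] at hs ⊢
  exact (T.I u).decode_nbr h' r' b (((T.I u).decode_speaks h' r').1 hs)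

/-- All certificates seen by `u` occur in the single instance `T.I u`, so any two that list the
neighbours of `r` agree. -/
theorem says_iff {u r h : V} (hr : G.Reachable u r) (hh : ∃ w : G.Walk u h, w.length ≤ k)
    (hs : decode (cert h) 6 (ident r) 0 ≠ 0) (b : ℕ) :
    T.Says u r b ↔ decode (cert h) 5 (ident r) b ≠ 0 := by
  obtain ⟨r', hr'⟩ := T.exists_isImage hr
  refine ⟨fun ⟨h', hw', hs', hb⟩ => ?_, fun hb => ⟨h, hh, hs, hb⟩⟩
  rw [T.says_iff_image hr' hh hs, ← T.says_iff_image hr' hw' hs']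
  exact hb

theorem exists_near_speaker {u r : V} (hr : G.Reachable u r) (h : T.φ (T.lv r) u < k) :
    ∃ h, (∃ w : G.Walk u h, w.length ≤ T.φ (T.lv r) u + 1) ∧
      decode (cert h) 6 (ident r) 0 ≠ 0 := by
  obtain ⟨x, hx, w, hw⟩ := T.layering.exists_near _ u h
  obtain ⟨h, h1, h2⟩ := T.exists_speaker (x := x) (w.reachable.symm.trans hr) hx
  refine ⟨h, ?_, h2⟩
  rcases h1 with rfl | h1
  · exact ⟨w, by omega⟩
  · exact ⟨w.concat h1, by rw [SimpleGraph.Walk.length_concat]; omega⟩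

theorem reachable_of_link {l : ℕ} {u v : V} (h : (linkGraph G k (T.φ l)).Reachable u v) :
    G.Reachable u v :=
  h.mono fun _ _ h => (show G.Adj _ _ ∧ _ from h).1

/-- The end of height at most `k - 2` has a speaker for `r` within distance `k - 1`, which both ends
see. This is why link edges need one such end. -/
theorem says_iff_of_link {u v r : V} (hr : G.Reachable u r)
    (h : (linkGraph G k (T.φ (T.lv r))).Adj u v) (b : ℕ) : T.Says u r b ↔ T.Says v r b := by
  wlog hv : T.φ (T.lv r) v + 2 ≤ k generalizing u v
  · have hu : T.φ (T.lv r) u + 2 ≤ k := h.2.2.2.resolve_right hv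
    exact (this (h.1.symm.reachable.trans hr) h.symm hu).symm
  have hvr := h.1.symm.reachable.trans hr
  obtain ⟨s, ⟨w, hw⟩, hs⟩ := T.exists_near_speaker hvr h.2.2.1
  rw [T.says_iff hr ⟨.cons h.1 w, by rw [SimpleGraph.Walk.length_cons]; omega⟩ hs,
    T.says_iff hvr ⟨w, by omega⟩ hs]

theorem says_iff_of_reachable {u v r : V} (hr : G.Reachable u r)
    (h : (linkGraph G k (T.φ (T.lv r))).Reachable u v) (b : ℕ) :
    T.Says u r b ↔ T.Says v r b := by
  obtain ⟨w⟩ := h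
  induction w with
  | nil => rfl
  | cons h _ ih =>
    exact (T.says_iff_of_link hr h b).trans (ih (h.1.symm.reachable.trans hr))

theorem says_self_iff (hk : 0 < k) (r : V) (b : ℕ) :
    T.Says r r b ↔ ∃ q, G.Adj r q ∧ ident q = b := by
  have h0 : T.φ (T.lv r) r = 0 := (T.layering.zero_iff _ _).2 le_rfl
  obtain ⟨h, ⟨w, hw⟩, hs⟩ := T.exists_near_speaker (.refl r) (by omega)
  have hi : T.IsImage r r (T.twin r) := T.isImage_of_ident_eq (.refl r) (T.isTwin r).ident_eq
  rw [T.says_iff (.refl r) ⟨w, by omega⟩ hs, T.says_iff_image hi ⟨w, by omega⟩ hs]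
  constructor
  · rintro ⟨q, hq, rfl⟩
    obtain ⟨v, hv, hv'⟩ := T.exists_adj_image hq
    exact ⟨v, hv, hv'.ident_eq.symm⟩
  · rintro ⟨q, hq, rfl⟩
    obtain ⟨v, hv, hv'⟩ := T.exists_image_adj hq
    exact ⟨v, hv, hv'.ident_eq⟩

/-- The instance of a vertex `y` represents correctly the neighbourhoods of the vertices which `y`
dominates. -/
theorem adj_image_iff (hk : 0 < k) {y v : V} (h : Layering.Dominates G k T.lv T.φ y v)
    {v' : (T.I y).V} (hv : T.IsImage y v v') (b : ℕ) :
    (∃ q, (T.I y).G.Adj v' q ∧ (T.I y).ident q = b) ↔ ∃ q, G.Adj v q ∧ ident q = b := by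
  have hyv : G.Reachable y v := (T.reachable_of_link h.2).symm
  have h0 : T.φ (T.lv v) y = 0 := (T.layering.zero_iff _ _).2 h.1
  obtain ⟨s, ⟨w, hw⟩, hs⟩ := T.exists_near_speaker hyv (by omega)
  rw [← T.says_self_iff hk, T.says_iff_of_reachable (.refl v) h.2,
    T.says_iff hyv ⟨w, by omega⟩ hs, T.says_iff_image hv ⟨w, by omega⟩ hs]

theorem exists_image_path (hk : 0 < k) {y : V} {m : ℕ} {p : ℕ → V} (hp : IsIndPath G m p)
    (S : Set ℕ) (hS : ∀ i ∈ S, i < m) (h : ∀ i ∈ S, Layering.Dominates G k T.lv T.φ y (p i)) :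
    ∃ f : ℕ → (T.I y).V, (∀ i ∈ S, T.IsImage y (p i) (f i)) ∧
      ∀ i ∈ S, ∀ j ∈ S, (f i = f j → i = j) ∧
        ((T.I y).G.Adj (f i) (f j) ↔ i + 1 = j ∨ j + 1 = i) := by
  classical
  have hex : ∀ i, ∃ r, i ∈ S → T.IsImage y (p i) r := by
    intro i
    by_cases hi : i ∈ S
    · obtain ⟨r, hr⟩ := T.exists_isImage (T.reachable_of_link (h i hi).2).symm
      exact ⟨r, fun _ => hr⟩
    · exact ⟨T.twin y, fun h => absurd h hi⟩
  choose f hf using hex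
  refine ⟨f, hf, fun i hi j hj => ⟨fun e => ?_, ?_⟩⟩
  · refine (hp i (hS i hi) j (hS j hj)).1 (T.inj ?_)
    rw [← (hf i hi).ident_eq, ← (hf j hj).ident_eq, e]
  · rw [← (hp i (hS i hi) j (hS j hj)).2]
    have := T.adj_image_iff hk (h i hi) (hf i hi) (ident (p j))
    constructor
    · intro ha
      obtain ⟨q, hq, he⟩ := this.1 ⟨f j, ha, (hf j hj).ident_eq⟩
      exact T.inj he ▸ hq
    · intro ha
      obtain ⟨q, hq, he⟩ := this.2 ⟨p j, ha, rfl⟩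
      rw [← (hf j hj).ident_eq] at he
      exact (T.I y).inj he ▸ hq

/-- The instance of the vertex dominating the second part contains a copy of that part, which is a
tail; the tail length it records is in the shared table. -/
theorem le_tail_of_splitsAt (hk : 0 < k) {m : ℕ} (hm : m ≤ 3 * k - 1) {p : ℕ → V}
    (hp : IsIndPath G m p) {l a : ℕ} (h : Layering.SplitsAt G k T.lv T.φ m p l a) :
    m - 1 - a ≤ T.tail l (p a) := by
  obtain ⟨ha, -, -, ⟨z, hz, hdom⟩, hlt, -⟩ := h
  obtain ⟨f, hf, hadj⟩ := T.exists_image_path hk hp {i | a ≤ i ∧ i < m} (fun i hi => hi.2)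
    (y := p z) fun i hi => hdom i hi.1 hi.2
  have hfa := hf a ⟨le_rfl, ha⟩
  rw [← hfa.tail_eq]
  refine (T.I (p z)).le_tail l (f a) (m - 1 - a) (fun i => f (a + i)) (by omega)
    ⟨rfl, fun i hi j hj => ?_, fun i h0 hi => ?_⟩
  · have := hadj (a + i) ⟨by omega, by omega⟩ (a + j) ⟨by omega, by omega⟩
    refine ⟨fun e => by have := this.1 e; omega, ?_⟩
    rw [this.2]; omega
  · rw [(hf (a + i) ⟨by omega, by omega⟩).φ_eq, hfa.φ_eq]
    exact hlt _ (by omega) (by omega)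

theorem _root_.LocalCert.HonestInstance.cl_tail_eq (I : HonestInstance k) {l q : ℕ} {v : I.V}
    {p : ℕ → I.V} (h : IsTail I.G (I.φ l) v q p) (hv : I.φ l v < k) (e : ℕ) (he : e ≤ q) :
    I.cl l (p e) = I.cl l v := by
  obtain ⟨h0, hp, hlt⟩ := h
  induction e with
  | zero => rw [h0]
  | succ e ih =>
    rw [← ih (by omega)]
    refine (I.lay.cl_eq l _ _ ⟨(hp e (by omega) (e + 1) (by omega)).2.2 (.inl rfl), ?_, ?_, ?_⟩).symm
    · rcases Nat.eq_zero_or_pos e with rfl | he0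
      · rwa [h0]
      · exact (hlt e he0 (by omega)).trans hv
    · exact (hlt _ (by omega) he).trans hv
    · right
      have := hlt (e + 1) (by omega) he
      omega

include T in
-- In the split case the second part itself need not appear in the instance of `p y`. It is replaced
-- there by another tail `τ` from the image of `p a`, which is enough for a contradiction with
-- `free`.
theorem not_exists_isIndPath (hk : 2 ≤ k) : ¬ ∃ p, IsIndPath G (3 * k - 1) p := by
  rintro ⟨p, hp⟩
  have hk0 : 0 < k := by omega
  have L := T.layering
  rcases L.dominates_or_splitsAt hk (by omega) le_rfl hp with ⟨y, hy, hdom⟩ | ⟨p, hp, l, a, h⟩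
  · obtain ⟨f, -, hadj⟩ := T.exists_image_path hk0 hp {i | i < 3 * k - 1} (fun i hi => hi) hdom
    exact (T.I (p y)).free ⟨f, hadj⟩
  have htail := T.le_tail_of_splitsAt hk0 le_rfl hp h
  obtain ⟨ha, hak, ⟨y, hy, hdom⟩, -, -, hnot⟩ := h
  obtain ⟨g, hg, hadj⟩ := T.exists_image_path hk0 hp {i | i ≤ a}
    (fun i hi => lt_of_le_of_lt hi ha) (y := p y) fun i hi => hdom i hi
  have hga := hg a (le_refl a)
  obtain ⟨τ, hτ⟩ := (T.I (p y)).exists_tail l (g a)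
  rw [hga.tail_eq] at hτ
  have hgak : (T.I (p y)).φ l (g a) < k := by rw [hga.φ_eq]; exact hak
  have hcl := fun e he => (T.I (p y)).cl_tail_eq hτ hgak e he
  obtain ⟨hτ0, hτp, hτlt⟩ := hτ
  -- A contact with the tail would give `g i` height at most that of `g a` and the same component
  -- name. Names being reliable in the network, `p i` would be linked to `p a`, against the
  -- splitting.
  have key : ∀ i < a, ∀ e, 0 < e → e ≤ T.tail l (p a) →
      g i ≠ τ e ∧ ¬ (T.I (p y)).G.Adj (g i) (τ e) := by
    intro i hi e he0 he
    have hgi := hg i (show i ≤ a by omega)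
    have h1 := hτlt e he0 he
    have contra : (T.I (p y)).φ l (g i) ≤ (T.I (p y)).φ l (g a) →
        (T.I (p y)).cl l (g i) ≠ (T.I (p y)).cl l (τ e) := by
      intro hle heq
      rw [hcl e he, hgi.cl_eq, hga.cl_eq] at heq
      rw [hgi.φ_eq, hga.φ_eq] at hle
      exact hnot i hi hle (L.reachable_of_cl_eq T.inj (by omega) hak heq)
    refine ⟨fun heq => contra (by rw [heq]; omega) (by rw [heq]), fun hadj => ?_⟩
    have h2 := (T.I (p y)).lay.lip l _ _ hadj
    exact contra (by omega) ((T.I (p y)).lay.cl_eq l _ _ ⟨hadj, by omega, by omega, by omega⟩)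
  refine (T.I (p y)).free ⟨fun i => if i ≤ a then g i else τ (i - a), fun i hi j hj => ?_⟩
  by_cases hia : i ≤ a <;> by_cases hja : j ≤ a <;> simp only [hia, hja, if_true, if_false]
  · exact hadj i hia j hja
  · rcases Nat.lt_or_ge i a with hlt | hge
    · have := key i hlt (j - a) (by omega) (by omega)
      exact ⟨fun e => absurd e this.1, fun e => absurd e this.2, fun e => by omega⟩
    · obtain rfl : i = a := by omega
      rw [← hτ0]
      have := hτp 0 (by omega) (j - i) (by omega)
      refine ⟨fun e => by have := this.1 e; omega, ?_⟩
      rw [this.2]; omega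
  · rcases Nat.lt_or_ge j a with hlt | hge
    · have := key j hlt (i - a) (by omega) (by omega)
      exact ⟨fun e => absurd e.symm this.1, fun e => absurd e.symm this.2, fun e => by omega⟩
    · obtain rfl : j = a := by omega
      rw [← hτ0]
      have := hτp (i - j) (by omega) 0 (by omega)
      refine ⟨fun e => by have := this.1 e; omega, ?_⟩
      rw [this.2]; omega
  · have := hτp (i - a) (by omega) (j - a) (by omega)
    refine ⟨fun e => by have := this.1 e; omega, ?_⟩
    rw [this.2]; omega

end Twinned

/-! ### Distributing the neighbourhood lists -/

theorem pow_succ_add_mul_pow_le (a n : ℕ) :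
    a ^ (n + 1) + (n + 1) * a ^ n ≤ (a + 1) ^ (n + 1) := by
  induction n with
  | zero => simp
  | succ n ih =>
    calc a ^ (n + 1 + 1) + (n + 1 + 1) * a ^ (n + 1)
        ≤ (a ^ (n + 1) + (n + 1) * a ^ n) * (a + 1) := by
          have : (a ^ (n + 1) + (n + 1) * a ^ n) * (a + 1) =
            a ^ (n + 1 + 1) + (n + 1 + 1) * a ^ (n + 1) + (n + 1) * a ^ n := by ring
          omega
      _ ≤ (a + 1) ^ (n + 1) * (a + 1) := by gcongr
      _ = (a + 1) ^ (n + 1 + 1) := (pow_succ _ _).symm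

/-- This is `(1 - 1/m)^m ≤ 1/2`: a random colouring misses a given colour on `m * L` vertices with
probability at most `2^(-L)`. -/
theorem two_mul_pred_pow_le (m : ℕ) (hm : 0 < m) : 2 * (m - 1) ^ m ≤ m ^ m := by
  obtain ⟨a, rfl⟩ : ∃ a, m = a + 1 := ⟨m - 1, by omega⟩
  have h := pow_succ_add_mul_pow_le a a
  have h2 : a * a ^ a ≤ (a + 1) * a ^ a := Nat.mul_le_mul_right _ (by omega)
  rw [← pow_succ'] at h2
  simp only [Nat.add_sub_cancel]
  omega

/-- If `n * m < 2 ^ L`, a graph on `n` vertices has a colouring with `m` colours such that each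
vertex of degree at least `m * L` has neighbours of all colours. -/
theorem exists_colouring [Fintype V] (G : SimpleGraph V) [DecidableRel G.Adj] (m L : ℕ)
    (hm : 0 < m) (h : Fintype.card V * m < 2 ^ L) :
    ∃ col : V → ℕ, (∀ v, col v < m) ∧
      ∀ x, m * L ≤ G.degree x → ∀ c < m, ∃ h, G.Adj x h ∧ col h = c := by
  classical
  set n := Fintype.card V with hn
  -- Colourings in which no neighbour of `xc.1` has colour `xc.2`. A union bound over at most `n *
  -- m` pairs leaves a good colouring.
  let bad : V × Fin m → Finset (V → Fin m) := fun xc =>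
    Fintype.piFinset fun h => if G.Adj xc.1 h then Finset.univ.erase xc.2 else Finset.univ
  have hbad : ∀ xc : V × Fin m, m * L ≤ G.degree xc.1 → 2 ^ L * (bad xc).card ≤ m ^ n := by
    intro xc hd
    have hdn : G.degree xc.1 ≤ n := (Finset.card_le_univ _).trans_eq hn.symm
    have hcard : (bad xc).card = (m - 1) ^ G.degree xc.1 * m ^ (n - G.degree xc.1) := by
      simp only [bad, Fintype.card_piFinset]
      rw [← Finset.prod_filter_mul_prod_filter_not Finset.univ (fun h => G.Adj xc.1 h)]
      congr 1
      · rw [Finset.prod_congr rfl (g := fun _ => m - 1), Finset.prod_const]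
        · congr 1
          rw [← G.card_neighborFinset_eq_degree, G.neighborFinset_eq_filter]
        · intro x hx
          rw [if_pos (Finset.mem_filter.1 hx).2, Finset.card_erase_of_mem (Finset.mem_univ _)]
          simp
      · rw [Finset.prod_congr rfl (g := fun _ => m), Finset.prod_const]
        · congr 1
          rw [← Finset.compl_filter, Finset.card_compl, ← G.card_neighborFinset_eq_degree,
            G.neighborFinset_eq_filter]
        · intro x hx
          rw [if_neg (Finset.mem_filter.1 hx).2]
          simp
    obtain ⟨e, he⟩ := Nat.exists_eq_add_of_le hd
    rw [hcard]
    calc 2 ^ L * ((m - 1) ^ G.degree xc.1 * m ^ (n - G.degree xc.1))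
        = (2 * (m - 1) ^ m) ^ L * (m - 1) ^ e * m ^ (n - G.degree xc.1) := by
          rw [he, pow_add, pow_mul, mul_pow]; ring
      _ ≤ (m ^ m) ^ L * m ^ e * m ^ (n - G.degree xc.1) := by
          gcongr
          · exact two_mul_pred_pow_le m hm
          · omega
      _ = m ^ n := by
          rw [← pow_mul, ← pow_add, ← he, ← pow_add]; congr 1; omega
  let S : Finset (V × Fin m) := Finset.univ.filter fun xc => m * L ≤ G.degree xc.1
  have hcov : (S.biUnion bad).card < Fintype.card (V → Fin m) := by
    have h1 : 2 ^ L * (S.biUnion bad).card ≤ n * m * m ^ n := by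
      calc 2 ^ L * (S.biUnion bad).card ≤ 2 ^ L * ∑ xc ∈ S, (bad xc).card := by
            gcongr; exact Finset.card_biUnion_le
        _ = ∑ xc ∈ S, 2 ^ L * (bad xc).card := Finset.mul_sum _ _ _
        _ ≤ ∑ _xc ∈ S, m ^ n :=
            Finset.sum_le_sum fun xc hxc => hbad xc (Finset.mem_filter.1 hxc).2
        _ = S.card * m ^ n := by rw [Finset.sum_const, smul_eq_mul]
        _ ≤ n * m * m ^ n := by
            gcongr
            refine (Finset.card_le_univ _).trans_eq ?_
            simp [hn]
    have h2 : n * m * m ^ n < 2 ^ L * m ^ n :=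
      Nat.mul_lt_mul_of_pos_right h (by positivity)
    rw [Fintype.card_fun, Fintype.card_fin]
    exact lt_of_mul_lt_mul_left (h1.trans_lt h2) (Nat.zero_le _)
  obtain ⟨f, hf⟩ : ∃ f, f ∉ S.biUnion bad := by
    by_contra hcon
    push Not at hcon
    rw [Finset.eq_univ_of_forall hcon, Finset.card_univ] at hcov
    exact lt_irrefl _ hcov
  refine ⟨fun v => f v, fun v => (f v).2, fun x hx c hc => ?_⟩
  by_contra hcon
  push Not at hcon
  refine hf (Finset.mem_biUnion.2 ⟨(x, ⟨c, hc⟩), by simp [S, hx], ?_⟩)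
  simp only [bad, Fintype.mem_piFinset]
  intro h
  split_ifs with ha
  · simpa [Fin.ext_iff] using hcon h ha
  · simp

/-- The vertices can be given a number below `m`, each being used at most `n / m + 1` times. -/
theorem exists_balanced [Fintype V] (m : ℕ) (hm : 0 < m) :
    ∃ g : V → ℕ, (∀ v, g v < m) ∧
      ∀ c, (Finset.univ.filter fun v => g v = c).card ≤ Fintype.card V / m + 1 := by
  classical
  let e := Fintype.equivFin V
  refine ⟨fun v => (e v : ℕ) % m, fun v => Nat.mod_lt _ hm, fun c => ?_⟩
  rw [← Finset.card_range (Fintype.card V / m + 1)]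
  refine Finset.card_le_card_of_injOn (fun v => (e v : ℕ) / m) (fun v _ => ?_) fun v hv w hw h => ?_
  · simp only [Finset.coe_range, Set.mem_Iio]
    exact Nat.lt_succ_of_le (Nat.div_le_div_right (e v).2.le)
  · simp only [Finset.coe_filter, Finset.mem_univ, true_and, Set.mem_ofPred_eq] at hv hw h
    refine e.injective (Fin.ext ?_)
    rw [← Nat.div_add_mod (e v) m, ← Nat.div_add_mod (e w) m, hv, hw, h]

/-- One can choose which neighbourhoods each vertex stores, such that a closed neighbourhood
of `x` contains those of all vertices of degree class at most that of `x`, and such that each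
vertex stores few edges. -/
theorem exists_speaks [Fintype V] (G : SimpleGraph V) [DecidableRel G.Adj] :
    ∃ speaks : V → V → Prop,
      (∀ x r, Nat.log 2 (G.degree r) ≤ Nat.log 2 (G.degree x) →
        ∃ h, (h = x ∨ G.Adj x h) ∧ speaks h r) ∧
      ∀ h, ∃ S : Finset V, (∀ r, speaks h r → r ∈ S) ∧ ∑ r ∈ S, G.degree r ≤
        10 * Fintype.card V * (Nat.log 2 (Fintype.card V) + 1) ^ 2 := by
  classical
  set n := Fintype.card V with hn
  set Λ := Nat.log 2 n with hΛ
  have hlt : n < 2 ^ (Λ + 1) := Nat.lt_pow_succ_log_self (by omega) _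
  -- With this `L`, `2 ^ L > n ^ 2 ≥ n * m l`. The number of colours is about `2 ^ l / L`, the most
  -- that vertices of degree `2 ^ l` can be guaranteed to see; with one colour, `x` itself speaks.
  let L := 2 * (Λ + 1)
  let m : ℕ → ℕ := fun l => max 1 (2 ^ l / L)
  have hm : ∀ l, 0 < m l := fun l => by simp [m]
  have hcol : ∀ l, ∃ col : V → ℕ, (∀ v, col v < m l) ∧
      (l ≤ Λ → ∀ x, m l * L ≤ G.degree x → ∀ c < m l, ∃ h, G.Adj x h ∧ col h = c) := by
    intro l
    by_cases hl : l ≤ Λ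
    · obtain ⟨col, h1, h2⟩ := exists_colouring G (m l) L (hm l) <| by
        rcases Nat.eq_zero_or_pos n with h0 | h0
        · rw [← hn, h0]; simp
        · have : m l ≤ n := by
            refine max_le h0 ((Nat.div_le_self _ _).trans ?_)
            exact (Nat.pow_le_pow_right (by omega) hl).trans (Nat.pow_log_le_self 2 h0.ne')
          calc n * m l ≤ n * n := by gcongr
            _ < 2 ^ (Λ + 1) * 2 ^ (Λ + 1) := by gcongr
            _ = 2 ^ L := by rw [← pow_add]; congr 1; omega
      exact ⟨col, h1, fun _ => h2⟩
    · exact ⟨fun _ => 0, fun _ => hm l, fun h => absurd h hl⟩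
  choose col hcol1 hcol2 using hcol
  choose g hg1 hg2 using fun l => exists_balanced (V := V) (m l) (hm l)
  have hlv : ∀ v, Nat.log 2 (G.degree v) ≤ Λ := fun v =>
    Nat.log_mono_right ((Finset.card_le_univ _).trans_eq hn.symm)
  refine ⟨fun h r => col (Nat.log 2 (G.degree r)) h = g (Nat.log 2 (G.degree r)) r, ?_, ?_⟩
  · intro x r hxr
    set l := Nat.log 2 (G.degree r) with hl
    by_cases h1 : m l = 1
    · refine ⟨x, .inl rfl, ?_⟩
      have h2 := hcol1 l x
      have h3 := hg1 l r
      rw [h1, Nat.lt_one_iff] at h2 h3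
      exact h2.trans h3.symm
    · have h2 : m l = 2 ^ l / L := by simp only [m] at h1 ⊢; omega
      have h3 : m l * L ≤ 2 ^ l := by rw [h2]; exact Nat.div_mul_le_self _ _
      -- `Nat.log 2 0 = 0` puts isolated vertices in class `0`, where there is only one colour.
      have hx0 : G.degree x ≠ 0 := by
        intro h0
        rw [h0] at hxr
        have hl0 : l = 0 := by simpa using hxr
        rw [hl0] at h3
        have h5 := hm 0
        rw [hl0] at h1
        have : m 0 * L ≥ 2 * 1 := Nat.mul_le_mul (by omega) (by simp only [L]; omega)
        omega
      have h4 : 2 ^ l ≤ G.degree x :=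
        (Nat.pow_le_pow_right (by omega) hxr).trans (Nat.pow_log_le_self 2 hx0)
      obtain ⟨h, h5, h6⟩ := hcol2 l (hlv r) x (h3.trans h4) _ (hg1 l r)
      exact ⟨h, .inr h5, h6⟩
  · intro h
    refine ⟨(Finset.range (Λ + 1)).biUnion fun l => Finset.univ.filter fun r =>
      Nat.log 2 (G.degree r) = l ∧ g l r = col l h, fun r hr => ?_, ?_⟩
    · simp only [Finset.mem_biUnion, Finset.mem_range, Finset.mem_filter, Finset.mem_univ, true_and]
      exact ⟨_, Nat.lt_succ_of_le (hlv r), rfl, hr.symm⟩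
    · have hlevel : ∀ l ∈ Finset.range (Λ + 1), (∑ r ∈ Finset.univ.filter fun r =>
          Nat.log 2 (G.degree r) = l ∧ g l r = col l h, G.degree r) ≤ 10 * n * (Λ + 1) := by
        intro l hl
        have hl : l ≤ Λ := Nat.le_of_lt_succ (Finset.mem_range.1 hl)
        rcases Nat.eq_zero_or_pos n with h0 | h0
        · exact absurd (Fintype.card_pos_iff.2 ⟨h⟩) (by omega)
        have hln : 2 ^ l ≤ n :=
          (Nat.pow_le_pow_right (by omega) hl).trans (Nat.pow_log_le_self 2 h0.ne')
        have hd : ∀ r ∈ Finset.univ.filter (fun r =>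
            Nat.log 2 (G.degree r) = l ∧ g l r = col l h), G.degree r ≤ 2 * 2 ^ l := by
          intro r hr
          have := Nat.lt_pow_succ_log_self (b := 2) (by omega) (G.degree r)
          rw [(Finset.mem_filter.1 hr).2.1, pow_succ] at this
          omega
        have hc : (Finset.univ.filter fun r =>
            Nat.log 2 (G.degree r) = l ∧ g l r = col l h).card ≤ n / m l + 1 :=
          (Finset.card_le_card fun r hr => by
            simp only [Finset.mem_filter, Finset.mem_univ, true_and] at hr ⊢
            exact hr.2).trans (hg2 l (col l h))
        -- Larger degrees come with proportionally more colours, so each level costs O(n log n)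
        -- edges.
        have hnm : n / m l * 2 ^ l ≤ 4 * n * (Λ + 1) := by
          have h1 : 2 ^ l ≤ m l * (4 * (Λ + 1)) := by
            have h2 := Nat.div_add_mod (2 ^ l) L
            have h3 := Nat.mod_lt (2 ^ l) (y := L) (by simp only [L]; omega)
            have h4 : 2 ^ l / L ≤ m l := le_max_right _ _
            have h5 := hm l
            calc 2 ^ l ≤ L * (2 ^ l / L) + L := by omega
              _ ≤ L * m l + L * m l :=
                add_le_add (Nat.mul_le_mul_left _ h4) (Nat.le_mul_of_pos_right _ h5)
              _ = m l * (4 * (Λ + 1)) := by simp only [L]; ring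
          calc n / m l * 2 ^ l ≤ n / m l * (m l * (4 * (Λ + 1))) := by gcongr
            _ = n / m l * m l * (4 * (Λ + 1)) := by ring
            _ ≤ n * (4 * (Λ + 1)) := by gcongr; exact Nat.div_mul_le_self _ _
            _ = 4 * n * (Λ + 1) := by ring
        calc _ ≤ (Finset.univ.filter fun r =>
              Nat.log 2 (G.degree r) = l ∧ g l r = col l h).card • (2 * 2 ^ l) :=
              Finset.sum_le_card_nsmul _ _ _ hd
          _ ≤ (n / m l + 1) * (2 * 2 ^ l) := by rw [smul_eq_mul]; gcongr
          _ = 2 * (n / m l * 2 ^ l) + 2 * 2 ^ l := by ring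
          _ ≤ 2 * (4 * n * (Λ + 1)) + 2 * n * (Λ + 1) := by
              refine add_le_add (by gcongr) ?_
              calc 2 * 2 ^ l ≤ 2 * n := by gcongr
                _ ≤ 2 * n * (Λ + 1) := Nat.le_mul_of_pos_right _ (by omega)
          _ = 10 * n * (Λ + 1) := by ring
      rw [Finset.sum_biUnion]
      · refine (Finset.sum_le_card_nsmul _ _ _ hlevel).trans_eq ?_
        rw [Finset.card_range, smul_eq_mul]; ring
      · intro l _ l' _ hne
        refine Finset.disjoint_left.2 fun r hr hr' => hne ?_
        rw [← (Finset.mem_filter.1 hr).2.1, (Finset.mem_filter.1 hr').2.1]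

/-! ### Construction of honest certificates -/

theorem exists_height (G : SimpleGraph V) (lv : V → ℕ) {k : ℕ} (hk : 0 < k) :
    ∃ φ : ℕ → V → ℕ, (∀ l v, φ l v ≤ k) ∧ (∀ l v, φ l v = 0 ↔ l ≤ lv v) ∧
      (∀ l u v, G.Adj u v → φ l u ≤ φ l v + 1) ∧
      (∀ l v, 0 < φ l v → φ l v < k → ∃ u, G.Adj v u ∧ φ l u + 1 = φ l v) ∧
      ∀ l, (∀ v, lv v < l) → ∀ v, φ l v = k := by
  classical
  let P : ℕ → V → ℕ → Prop := fun l v d => d = k ∨ ∃ x, l ≤ lv x ∧ ∃ w : G.Walk v x, w.length = d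
  have hP : ∀ l v, ∃ d, P l v d := fun l v => ⟨k, .inl rfl⟩
  have hle : ∀ l v, Nat.find (hP l v) ≤ k := fun l v => Nat.find_min' _ (.inl rfl)
  have hlip : ∀ l u v, G.Adj u v → Nat.find (hP l u) ≤ Nat.find (hP l v) + 1 := by
    intro l u v h
    rcases Nat.find_spec (hP l v) with h1 | ⟨x, hx, w, hw⟩
    · have := hle l u
      omega
    · exact Nat.find_min' _ (.inr ⟨x, hx, .cons h w, by rw [SimpleGraph.Walk.length_cons, hw]⟩)
  refine ⟨fun l v => Nat.find (hP l v), hle, fun l v => ?_, hlip, fun l v h0 hlt => ?_,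
    fun l hl v => ?_⟩
  · dsimp only
    rw [Nat.find_eq_zero]
    constructor
    · rintro (h | ⟨x, hx, w, hw⟩)
      · omega
      · rw [SimpleGraph.Walk.eq_of_length_eq_zero hw]; exact hx
    · exact fun h => .inr ⟨v, h, .nil, rfl⟩
  · dsimp only at h0 hlt ⊢
    rcases Nat.find_spec (hP l v) with h1 | ⟨x, hx, w, hw⟩
    · omega
    · cases w with
      | nil => simp at hw; omega
      | @cons _ u _ h w =>
        refine ⟨u, h, ?_⟩
        have h1 : Nat.find (hP l u) ≤ w.length := Nat.find_min' _ (.inr ⟨x, hx, w, rfl⟩)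
        have h2 := hlip l v u h
        rw [SimpleGraph.Walk.length_cons] at hw
        omega
  · rcases Nat.find_spec (hP l v) with h1 | ⟨x, hx, -⟩
    · exact h1
    · exact absurd (hl x) (by omega)

theorem exists_adj_dist_lt {G : SimpleGraph V} {u v : V} (h : G.Reachable u v) (hne : u ≠ v) :
    ∃ w, G.Adj u w ∧ G.dist w v < G.dist u v := by
  obtain ⟨p, hp⟩ := h.exists_walk_length_eq_dist
  cases p with
  | nil => exact absurd rfl hne
  | @cons _ w _ ha q =>
    refine ⟨w, ha, ?_⟩
    have := SimpleGraph.dist_le q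
    rw [SimpleGraph.Walk.length_cons] at hp
    omega

/-- Leaders are chosen representatives of the link components, and `t` is the distance to them in
the link graph. Above `Λ` all heights are `k`, so no link edge exists and the names can be set to
`0`, which keeps the table finite. -/
theorem exists_layering [Fintype V] (G : SimpleGraph V) (ident : V → ℕ) (lv : V → ℕ) {k Λ B : ℕ}
    (hk : 0 < k) (hlv : ∀ v, lv v ≤ Λ) (hid : ∀ v, ident v < B) :
    ∃ φ cl t : ℕ → V → ℕ, Layering G ident k lv φ cl t ∧
      (∀ l v, cl l v < B) ∧ (∀ l v, t l v < Fintype.card V) ∧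
      ∀ l v, Λ < l → φ l v = k ∧ cl l v = 0 ∧ t l v = 0 := by
  classical
  obtain ⟨φ, h1, h2, h3, h4, h5⟩ := exists_height G lv hk
  have h6 : ∀ l v, Λ < l → φ l v = k := fun l v hl => h5 l (fun x => (hlv x).trans_lt hl) v
  let rt : ℕ → V → V := fun l v => ((linkGraph G k (φ l)).connectedComponentMk v).out
  have hrt : ∀ l v, (linkGraph G k (φ l)).Reachable v (rt l v) := fun l v =>
    (SimpleGraph.ConnectedComponent.exact (Quot.out_eq _)).symm
  refine ⟨φ, fun l v => if l ≤ Λ then ident (rt l v) else 0,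
    fun l v => if l ≤ Λ then (linkGraph G k (φ l)).dist v (rt l v) else 0,
    ⟨h1, h2, h3, h4, fun l u v h => ?_, fun l v h => ?_⟩, fun l v => ?_, fun l v => ?_,
    fun l v hl => ?_⟩
  · have : rt l u = rt l v := by
      simp only [rt]
      rw [SimpleGraph.ConnectedComponent.sound h.reachable]
    simp only [this]
  · have hl : l ≤ Λ := by
      by_contra hl
      have := h6 l v (by omega)
      omega
    simp only [hl, if_true]
    by_cases hv : v = rt l v
    · exact .inl (by rw [← hv])
    · obtain ⟨w, hw, hd⟩ := exists_adj_dist_lt (hrt l v) hv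
      have : rt l w = rt l v := by
        simp only [rt]
        rw [SimpleGraph.ConnectedComponent.sound hw.reachable]
      exact .inr ⟨w, hw, by rw [this]; exact hd⟩
  · have := hid v
    dsimp only
    split_ifs
    · exact hid _
    · omega
  · dsimp only
    split_ifs
    · obtain ⟨p, hp, hd⟩ := (hrt l v).exists_path_of_dist
      rw [← hd]
      exact hp.length_lt
    · exact Fintype.card_pos_iff.2 ⟨v⟩
  · have hl' : ¬ l ≤ Λ := by omega
    exact ⟨h6 l v hl, by simp [hl'], by simp [hl']⟩

theorem exists_tail_length (G : SimpleGraph V) (φ : ℕ → V → ℕ) {k : ℕ} (hk : 0 < k) :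
    ∃ tail : ℕ → V → ℕ, (∀ l v, ∃ p, IsTail G (φ l) v (tail l v) p) ∧
      (∀ l v q p, q < 3 * k → IsTail G (φ l) v q p → q ≤ tail l v) ∧
      (∀ l v, tail l v < 3 * k) ∧ ∀ l, (∀ u v, φ l u = φ l v) → ∀ v, tail l v = 0 := by
  classical
  let P : ℕ → V → ℕ → Prop := fun l v q => ∃ p, IsTail G (φ l) v q p
  have h0 : ∀ l v, P l v 0 := fun l v => ⟨fun _ => v, rfl, fun i hi j hj => by
    obtain rfl : i = 0 := by omega
    obtain rfl : j = 0 := by omega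
    simp, fun i h1 h2 => by omega⟩
  have hs : ∀ l v, P l v (Nat.findGreatest (P l v) (3 * k - 1)) := fun l v =>
    Nat.findGreatest_spec (Nat.zero_le _) (h0 l v)
  refine ⟨fun l v => Nat.findGreatest (P l v) (3 * k - 1), hs,
    fun l v q p hq hp => Nat.le_findGreatest (by omega) ⟨p, hp⟩, fun l v => ?_, fun l hl v => ?_⟩
  · have := Nat.findGreatest_le (P := P l v) (3 * k - 1)
    dsimp only
    omega
  · obtain ⟨p, -, -, h⟩ := hs l v
    by_contra hne
    have := h 1 (by omega) (Nat.one_le_iff_ne_zero.2 hne)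
    rw [hl (p 1) v] at this
    exact lt_irrefl _ this

open Classical in
/-- What a certificate tells about the vertex `r`; `s` says whether it contains the neighbourhood
of `r`. -/
noncomputable def certEntry (G : SimpleGraph V) (ident : V → ℕ) (k : ℕ) (lv : V → ℕ)
    (φ cl t tail : ℕ → V → ℕ) (s : Prop) (r : V) : ℕ → ℕ → ℕ
  -- Only nonzero values are stored: `k - φ` vanishes at all levels above the maximum, and in tag
  -- `4` the shift `lv + 1` makes a nonzero value witness that the identifier is in use.
  | 0, b => k - φ b r
  | 1, b => cl b r
  | 2, b => t b r
  | 3, b => tail b r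
  | 4, b => if b = 0 then lv r + 1 else 0
  | 5, b => if s ∧ ∃ q, G.Adj r q ∧ ident q = b then 1 else 0
  | 6, b => if s ∧ b = 0 then 1 else 0
  | _, _ => 0

open Classical in
/-- The function with value `f r c b` at `(c, ident r, b)`. -/
noncomputable def onIdent (ident : V → ℕ) (f : V → ℕ → ℕ → ℕ) (c a b : ℕ) : ℕ :=
  if h : ∃ r, ident r = a then f h.choose c b else 0

theorem onIdent_ident {ident : V → ℕ} (hid : Function.Injective ident) (f : V → ℕ → ℕ → ℕ)
    (c b : ℕ) (r : V) : onIdent ident f c (ident r) b = f r c b := by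
  unfold onIdent
  have h : ∃ r', ident r' = ident r := ⟨r, rfl⟩
  rw [dif_pos h, hid h.choose_spec]

theorem exists_of_onIdent_ne_zero {ident : V → ℕ} {f : V → ℕ → ℕ → ℕ} {c a b : ℕ}
    (h : onIdent ident f c a b ≠ 0) : ∃ r, ident r = a := by
  by_contra hr
  exact h (by unfold onIdent; rw [dif_neg hr])

theorem certEntry_support [Fintype V] {G : SimpleGraph V} [DecidableRel G.Adj] {ident : V → ℕ}
    {k Λ B : ℕ} {lv : V → ℕ} {φ cl t tail : ℕ → V → ℕ} {speaks : V → Prop} {S : Finset V} {N : ℕ}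
    (hk : 0 < k) (hid : Function.Injective ident) (hB : ∀ v, ident v < 2 ^ B)
    (hΛ : Λ = Nat.log 2 (Fintype.card V)) (hlv : ∀ v, lv v ≤ Λ)
    (hcl : ∀ l v, cl l v < 2 ^ B) (ht : ∀ l v, t l v < Fintype.card V)
    (htail : ∀ l v, tail l v < 3 * k)
    (hzero : ∀ l v, Λ < l → φ l v = k ∧ cl l v = 0 ∧ t l v = 0) (hzero' : ∀ l v, Λ < l → tail l v = 0)
    (hS : ∀ r, speaks r → r ∈ S) (hN : ∑ r ∈ S, G.degree r ≤ N) :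
    ∃ K : Finset (ℕ × ℕ × ℕ),
      K.card ≤ 4 * (Fintype.card V * (Λ + 1)) + 2 * Fintype.card V + N ∧
      (∀ c a b, onIdent ident (fun r => certEntry G ident k lv φ cl t tail (speaks r) r) c a b ≠ 0 →
        (c, a, b) ∈ K) ∧
      ∀ x ∈ K, x.1 < 2 ^ (B + Λ + 3 * k + 4) ∧ x.2.1 < 2 ^ (B + Λ + 3 * k + 4) ∧
        x.2.2 < 2 ^ (B + Λ + 3 * k + 4) ∧
        onIdent ident (fun r => certEntry G ident k lv φ cl t tail (speaks r) r) x.1 x.2.1 x.2.2 <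
          2 ^ (B + Λ + 3 * k + 4) := by
  classical
  set w := B + Λ + 3 * k + 4 with hw
  have pw : ∀ a, a ≤ w → 2 ^ a ≤ 2 ^ w := fun a ha => Nat.pow_le_pow_right (by omega) ha
  have hBw : 2 ^ B ≤ 2 ^ w := pw _ (by omega)
  have h16 : 2 ^ 4 ≤ 2 ^ w := pw _ (by omega)
  have hcard : Fintype.card V < 2 ^ (Λ + 1) := hΛ ▸ Nat.lt_pow_succ_log_self (by omega) _
  have hΛw : 2 ^ (Λ + 1) ≤ 2 ^ w := pw _ (by omega)
  have hΛ2 : Λ + 1 < 2 ^ (Λ + 1) := Nat.lt_two_pow_self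
  have hkw : 2 ^ (3 * k) ≤ 2 ^ w := pw _ (by omega)
  have hk2 : 3 * k < 2 ^ (3 * k) := Nat.lt_two_pow_self
  have hval : ∀ c b r, certEntry G ident k lv φ cl t tail (speaks r) r c b < 2 ^ w := by
    intro c b r
    have h1 := hcl b r
    have h2 := ht b r
    have h3 := htail b r
    have h4 := hlv r
    unfold certEntry
    split <;> (try split_ifs) <;> omega
  let K₁ : Finset (ℕ × ℕ × ℕ) :=
    Finset.range 4 ×ˢ (Finset.univ.image ident ×ˢ Finset.range (Λ + 1))
  let K₂ : Finset (ℕ × ℕ × ℕ) := Finset.univ.image fun r => (4, ident r, 0)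
  let K₃ : Finset (ℕ × ℕ × ℕ) := Finset.univ.image fun r => (6, ident r, 0)
  let K₄ : Finset (ℕ × ℕ × ℕ) := (S.sigma fun r => G.neighborFinset r).image fun x =>
    (5, ident x.1, ident x.2)
  refine ⟨K₁ ∪ K₂ ∪ K₃ ∪ K₄, ?_, ?_, ?_⟩
  · have h1 : K₁.card ≤ 4 * (Fintype.card V * (Λ + 1)) := by
      simp only [K₁, Finset.card_product, Finset.card_range]
      gcongr
      exact Finset.card_image_le.trans_eq Finset.card_univ
    have h2 : K₂.card ≤ Fintype.card V := Finset.card_image_le.trans_eq Finset.card_univ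
    have h3 : K₃.card ≤ Fintype.card V := Finset.card_image_le.trans_eq Finset.card_univ
    have h4 : K₄.card ≤ N := by
      refine (Finset.card_image_le.trans_eq ?_).trans hN
      rw [Finset.card_sigma]
      exact Finset.sum_congr rfl fun r _ => G.card_neighborFinset_eq_degree r
    have h5 := Finset.card_union_le (K₁ ∪ K₂ ∪ K₃) K₄
    have h6 := Finset.card_union_le (K₁ ∪ K₂) K₃
    have h7 := Finset.card_union_le K₁ K₂
    omega
  · intro c a b h
    obtain ⟨r, rfl⟩ := exists_of_onIdent_ne_zero h
    rw [onIdent_ident hid] at h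
    simp only [Finset.mem_union, K₁, K₂, K₃, K₄, Finset.mem_product, Finset.mem_range,
      Finset.mem_image, Finset.mem_univ, true_and, Prod.mk.injEq, Finset.mem_sigma]
    have small : (Λ < b → certEntry G ident k lv φ cl t tail (speaks r) r c b = 0) → c < 4 →
        c < 4 ∧ (∃ r', ident r' = ident r) ∧ b < Λ + 1 := fun h1 h2 =>
      ⟨h2, ⟨r, rfl⟩, by by_contra h3; exact h (h1 (by omega))⟩
    match c, h, small with
    | 0, h, small =>
      exact .inl (.inl (.inl (small (fun h1 => by simp [certEntry, hzero b r h1]) (by omega))))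
    | 1, h, small =>
      exact .inl (.inl (.inl (small (fun h1 => by simp [certEntry, hzero b r h1]) (by omega))))
    | 2, h, small =>
      exact .inl (.inl (.inl (small (fun h1 => by simp [certEntry, hzero b r h1]) (by omega))))
    | 3, h, small =>
      exact .inl (.inl (.inl (small (fun h1 => by simp [certEntry, hzero' b r h1]) (by omega))))
    | 4, h, _ =>
      have hb : b = 0 := by by_contra hb; simp [certEntry, hb] at h
      exact .inl (.inl (.inr ⟨r, rfl, rfl, hb.symm⟩))
    | 5, h, _ =>
      have hb : speaks r ∧ ∃ q, G.Adj r q ∧ ident q = b := by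
        by_contra hb; simp only [certEntry, if_neg hb, ne_eq, not_true_eq_false] at h
      obtain ⟨hs, q, hq, rfl⟩ := hb
      exact .inr ⟨⟨r, q⟩, ⟨hS r hs, by simpa using hq⟩, rfl, rfl, rfl⟩
    | 6, h, _ =>
      have hb : speaks r ∧ b = 0 := by
        by_contra hb; simp only [certEntry, if_neg hb, ne_eq, not_true_eq_false] at h
      exact .inl (.inr ⟨r, rfl, rfl, hb.2.symm⟩)
    | n + 7, h, _ => exact absurd rfl h
  · rintro ⟨c, a, b⟩ hx
    have hon : onIdent ident (fun r => certEntry G ident k lv φ cl t tail (speaks r) r) c a b <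
        2 ^ w := by
      unfold onIdent
      split_ifs
      · exact hval _ _ _
      · positivity
    refine and_assoc.1 (and_assoc.1 ⟨?_, hon⟩)
    simp only [Finset.mem_union, K₁, K₂, K₃, K₄, Finset.mem_product, Finset.mem_range,
      Finset.mem_image, Finset.mem_univ, true_and, Prod.mk.injEq, Finset.mem_sigma] at hx
    rcases hx with ((⟨h1, ⟨r, rfl⟩, h3⟩ | ⟨r, rfl, rfl, rfl⟩) | ⟨r, rfl, rfl, rfl⟩) |
      ⟨⟨r, q⟩, -, rfl, rfl, rfl⟩
    · have := hB r
      refine ⟨⟨?_, ?_⟩, ?_⟩ <;> dsimp only <;> omega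
    · have := hB r
      refine ⟨⟨?_, ?_⟩, ?_⟩ <;> dsimp only <;> omega
    · have := hB r
      refine ⟨⟨?_, ?_⟩, ?_⟩ <;> dsimp only <;> omega
    · have := hB r
      have := hB q
      refine ⟨⟨?_, ?_⟩, ?_⟩ <;> dsimp only <;> omega

/-- Honest certificates of moderate size exist in graphs without long induced paths. -/
theorem exists_honest_cert [Fintype V] {k B : ℕ} (hk : 0 < k) (G : SimpleGraph V) (ident : V → ℕ)
    (hid : Function.Injective ident) (hB : ∀ v, ident v < 2 ^ B)
    (hfree : ¬ ∃ p, IsIndPath G (3 * k - 1) p) :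
    ∃ cert : V → List Bool,
      (∀ v, (cert v).length ≤ 16 * Fintype.card V * (Nat.log 2 (Fintype.card V) + 1) ^ 2 *
        (4 * (2 * (B + Nat.log 2 (Fintype.card V) + 3 * k + 4) + 1))) ∧
      ∀ d v, ∃ (I : HonestInstance k) (v' : I.V),
        viewAt I.G I.ident I.cert d v' = viewAt G ident cert d v := by
  classical
  set n := Fintype.card V with hn
  set Λ := Nat.log 2 n with hΛ
  obtain ⟨speaks, hhit, hload⟩ := exists_speaks G
  have hlv : ∀ v, Nat.log 2 (G.degree v) ≤ Λ := fun v =>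
    Nat.log_mono_right (Finset.card_le_univ _)
  obtain ⟨φ, cl, t, hlay, hcl, ht, hzero⟩ :=
    exists_layering G ident (fun v => Nat.log 2 (G.degree v)) hk hlv hB
  obtain ⟨tail, htail1, htail2, htail3, htail4⟩ := exists_tail_length G φ hk
  have hzero' : ∀ l v, Λ < l → tail l v = 0 := fun l v hl =>
    htail4 l (fun u v => by rw [(hzero l u hl).1, (hzero l v hl).1]) v
  let F : V → ℕ → ℕ → ℕ → ℕ := fun h => onIdent ident fun r =>
    certEntry G ident k (fun v => Nat.log 2 (G.degree v)) φ cl t tail (speaks h r) r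
  have hF : ∀ h, ∃ s : List Bool, decode s = F h ∧
      s.length ≤ 16 * n * (Λ + 1) ^ 2 * (4 * (2 * (B + Λ + 3 * k + 4) + 1)) := by
    intro h
    obtain ⟨S, hS1, hS2⟩ := hload h
    obtain ⟨K, hK1, hK2, hK3⟩ := certEntry_support hk hid hB hΛ hlv hcl ht htail3 hzero hzero'
      hS1 hS2
    obtain ⟨s, hs1, hs2⟩ := exists_decode_eq (F h) K _ hK2 hK3
    -- The constant is `16 = 4 + 2 + 10`: four tables indexed by vertex and level, the entries with
    -- tags `4` and `6`, and the stored edges.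
    refine ⟨s, hs1, hs2.trans (Nat.mul_le_mul_right _ (hK1.trans ?_))⟩
    have h1 : n * (Λ + 1) ≤ n * (Λ + 1) ^ 2 :=
      Nat.mul_le_mul_left _ (Nat.le_self_pow (by omega) _)
    have h2 : n ≤ n * (Λ + 1) ^ 2 := Nat.le_mul_of_pos_right _ (by positivity)
    have h3 : 10 * n * (Λ + 1) ^ 2 = 10 * (n * (Λ + 1) ^ 2) := by ring
    have h4 : 16 * n * (Λ + 1) ^ 2 = 16 * (n * (Λ + 1) ^ 2) := by ring
    simp only [← hn, ← hΛ]
    omega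
  choose cert hdec hlen using hF
  have hent : ∀ h c r b, decode (cert h) c (ident r) b =
      certEntry G ident k (fun v => Nat.log 2 (G.degree v)) φ cl t tail (speaks h r) r c b :=
    fun h c r b => by rw [hdec]; exact onIdent_ident hid _ _ _ _
  let I : HonestInstance k :=
    { V := V, G := G, ident := ident, cert := cert, lv := fun v => Nat.log 2 (G.degree v)
      φ := φ, cl := cl, t := t, tail := tail, speaks := speaks, inj := hid, lay := hlay
      hit := hhit, exists_tail := htail1, le_tail := htail2
      common := fun h h' c hc => by
        funext a b
        rw [hdec, hdec]
        simp only [F, onIdent]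
        split_ifs
        · match c, hc with
          | 0, _ => rfl
          | 1, _ => rfl
          | 2, _ => rfl
          | 3, _ => rfl
          | 4, _ => rfl
        · rfl
      decode_φ := fun h r l => hent h 0 r l
      decode_cl := fun h r l => hent h 1 r l
      decode_t := fun h r l => hent h 2 r l
      decode_tail := fun h r l => hent h 3 r l
      decode_lv := fun h r => by rw [hent]; simp [certEntry]
      exists_ident := fun h a ha => by
        rw [hdec] at ha
        exact exists_of_onIdent_ne_zero ha
      decode_speaks := fun h r => by rw [hent]; simp [certEntry]
      decode_nbr := fun h r b hs => by rw [hent]; simp [certEntry, hs]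
      free := hfree }
  exact ⟨cert, hlen, fun d v => ⟨I, v, rfl⟩⟩

/-! ### From equal views to twins, and the verification algorithm -/

section View

variable {G : SimpleGraph V} {ident : V → ℕ} {cert : V → List Bool} {k : ℕ} {u v : V}
  {H : SimpleGraph W} {ident' : W → ℕ} {cert' : W → List Bool} {u' : W}

theorem exists_label_of_viewAt_eq (h : viewAt G ident cert k u = viewAt H ident' cert' k u')
    (hv : G.edist u v ≤ k) : ∃ v', ident' v' = ident v ∧ cert' v' = cert v := by
  have h1 : (ident v, cert v) ∈ (viewAt G ident cert k u).labels := ⟨v, hv, rfl⟩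
  rw [h] at h1
  obtain ⟨v', -, h2⟩ := h1
  exact ⟨v', (congrArg Prod.fst h2).symm, (congrArg Prod.snd h2).symm⟩

theorem viewAt_adj_of_adj (hk : 2 ≤ k) (huv : G.Adj u v) :
    (viewAt G ident cert k u).adj (ident u) (ident v) := by
  have h0 : G.edist u u = 0 := SimpleGraph.edist_self
  have h1 : G.edist u v ≤ k := by
    rw [SimpleGraph.edist_eq_one_iff_adj.2 huv]
    exact_mod_cast (by omega : 1 ≤ k)
  refine ⟨u, v, rfl, rfl, huv, by simp, h1, fun ⟨h2, _⟩ => ?_⟩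
  rw [h0] at h2
  have : (0 : ℕ) = k := by exact_mod_cast h2
  omega

theorem exists_adj_of_viewAt_eq (hk : 2 ≤ k) (hinj : Function.Injective ident')
    (h : viewAt G ident cert k u = viewAt H ident' cert' k u')
    (huv : G.Adj u v) : ∃ v', H.Adj u' v' ∧ ident' v' = ident v ∧ cert' v' = cert v := by
  have h1 := viewAt_adj_of_adj (ident := ident) (cert := cert) hk huv
  rw [h] at h1
  obtain ⟨a, b, ha, hb, hab, -⟩ := h1
  have hc : ident u = ident' u' := congrArg View.center h
  obtain rfl : a = u' := hinj (ha.trans hc)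
  have hd : H.edist a b ≤ k := by
    rw [SimpleGraph.edist_eq_one_iff_adj.2 hab]
    exact_mod_cast (by omega : 1 ≤ k)
  have h2 : (ident' b, cert' b) ∈ (viewAt H ident' cert' k a).labels := ⟨b, hd, rfl⟩
  rw [← h] at h2
  obtain ⟨x, hx, h3⟩ := h2
  have h4 : (ident v, cert v) ∈ (viewAt G ident cert k u).labels :=
    ⟨v, by rw [SimpleGraph.edist_eq_one_iff_adj.2 huv]; exact_mod_cast (by omega : 1 ≤ k), rfl⟩
  rw [h] at h4
  obtain ⟨y, -, h5⟩ := h4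
  obtain rfl : y = b := hinj ((congrArg Prod.fst h5).symm.trans hb.symm)
  exact ⟨y, hab, hb, (congrArg Prod.snd h5).symm⟩

/-- A vertex with the same view is a twin, also when the isolated vertices are deleted. -/
theorem isTwin_of_viewAt_eq (hk : 2 ≤ k) (hinj : Function.Injective ident) {f : W → V}
    (hf : ∀ w v, G.Adj (f w) v → ∃ w', f w' = v) (I : HonestInstance k) {w : W} {x : I.V}
    (h : viewAt I.G I.ident I.cert k x = viewAt G ident cert k (f w)) :
    IsTwin (G.comap f) (ident ∘ f) (cert ∘ f) w I x where
  ident_eq := congrArg View.center h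
  cert_eq := by
    have h1 : (ident (f w), cert (f w)) ∈ (viewAt G ident cert k (f w)).labels :=
      ⟨f w, by simp, rfl⟩
    rw [← h] at h1
    obtain ⟨y, -, h2⟩ := h1
    have h3 : I.ident x = ident (f w) := congrArg View.center h
    obtain rfl : x = y := I.inj (h3.trans (congrArg Prod.fst h2))
    exact (congrArg Prod.snd h2).symm
  adj := fun v hv => exists_adj_of_viewAt_eq (v := f v) hk I.inj h.symm hv
  adj' := fun v' hv' => by
    obtain ⟨y, hy, h1, h2⟩ := exists_adj_of_viewAt_eq hk hinj h hv'
    obtain ⟨z, rfl⟩ := hf w y hy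
    exact ⟨z, hy, h1.symm, h2.symm⟩
  near := fun v p hp => by
    have h1 : G.edist (f w) (f v) ≤ k := by
      refine (SimpleGraph.edist_le (p.map (SimpleGraph.Hom.comap f G))).trans ?_
      rw [SimpleGraph.Walk.length_map]
      exact_mod_cast hp
    obtain ⟨v', -, h2⟩ := exists_label_of_viewAt_eq h.symm h1
    exact ⟨v', h2⟩

end View

/-- A view is accepted if it has no edge or if it is the view of a vertex of an honest instance. -/
def Accepted (k : ℕ) (w : View) : Prop :=
  (∀ a b, ¬ w.adj a b) ∨
    ∃ (I : HonestInstance k) (v : I.V), viewAt I.G I.ident I.cert k v = w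

/-- Vertices accepted for lack of edges have no twin, but they are isolated and lie on no induced
path with at least two vertices. The argument is run on the graph without isolated vertices. -/
theorem inducedFree_of_accepted {k : ℕ} (hk : 2 ≤ k) {G : SimpleGraph V} {ident : V → ℕ}
    (hinj : Function.Injective ident) {cert : V → List Bool}
    (h : ∀ v, Accepted k (viewAt G ident cert k v)) :
    InducedFree (SimpleGraph.pathGraph (3 * k - 1)) G := by
  classical
  rw [inducedFree_pathGraph_iff (by omega)]
  rintro ⟨p, hp⟩
  let f : {v // ∃ u, G.Adj v u} → V := Subtype.val
  have hf : ∀ w v, G.Adj (f w) v → ∃ w', f w' = v := fun w v hv => ⟨⟨v, f w, hv.symm⟩, rfl⟩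
  have hI : ∀ w, ∃ (I : HonestInstance k) (x : I.V),
      viewAt I.G I.ident I.cert k x = viewAt G ident cert k (f w) := fun w => by
    obtain ⟨u, hu⟩ := w.2
    exact (h w.1).resolve_left fun h1 => h1 _ _ (viewAt_adj_of_adj hk hu)
  choose I x hx using hI
  let T : Twinned k (G.comap f) (ident ∘ f) (cert ∘ f) :=
    { I := I
      twin := x
      isTwin := fun w => isTwin_of_viewAt_eq hk hinj hf (I w) (hx w)
      inj := hinj.comp Subtype.val_injective }
  have hmem : ∀ i < 3 * k - 1, ∃ u, G.Adj (p i) u := fun i hi => by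
    rcases Nat.eq_zero_or_pos i with rfl | h0
    · exact ⟨p 1, (hp 0 hi 1 (by omega)).2.2 (by omega)⟩
    · exact ⟨p (i - 1), (hp i hi (i - 1) (by omega)).2.2 (by omega)⟩
  let w0 : {v // ∃ u, G.Adj v u} := ⟨p 0, hmem 0 (by omega)⟩
  let q : ℕ → {v // ∃ u, G.Adj v u} := fun i =>
    if hi : i < 3 * k - 1 then ⟨p i, hmem i hi⟩ else w0
  have hq : ∀ i < 3 * k - 1, f (q i) = p i := fun i hi => by simp [q, hi, f]
  refine T.not_exists_isIndPath hk ⟨q, fun i hi j hj => ?_⟩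
  have h1 := hp i hi j hj
  rw [← hq i hi, ← hq j hj] at h1
  exact ⟨fun h2 => h1.1 (congrArg f h2), h1.2⟩

/-! ### Certificate sizes -/

theorem hasLocalCertification_of_le {k : ℕ} (hk : 2 ≤ k) {idBits : ℕ → ℕ} {s : ℕ → ℝ}
    (hs : ∀ n, 2 ≤ n → ((16 * n * (Nat.log 2 n + 1) ^ 2 *
      (4 * (2 * (idBits n + Nat.log 2 n + 3 * k + 4) + 1)) : ℕ) : ℝ) ≤ s n) (hs1 : 0 ≤ s 1) :
    HasLocalCertification idBits k s
      (fun _ G => InducedFree (SimpleGraph.pathGraph (3 * k - 1)) G) := by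
  classical
  refine ⟨fun w => decide (Accepted k w), fun V _ G ident ⟨hinj, hB⟩ =>
    ⟨fun hG => ?_, fun hG cert => ?_⟩⟩
  -- For one vertex `log n = 0` may force the empty certificate; this is why edgeless views are
  -- accepted.
  · rcases lt_or_ge (Fintype.card V) 2 with hn | hn
    · have : Subsingleton V := Fintype.card_le_one_iff_subsingleton.1 (by omega)
      refine ⟨fun _ => [], fun v => ?_, fun v => decide_eq_true (Or.inl ?_)⟩
      · have : Fintype.card V = 1 := by
          have := Fintype.card_pos_iff.2 ⟨v⟩
          omega
        simpa [this] using hs1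
      · rintro a b ⟨u, w, -, -, huw, -⟩
        exact huw.ne (Subsingleton.elim _ _)
    · have hG := (inducedFree_pathGraph_iff (by omega)).1 hG
      obtain ⟨cert, h1, h2⟩ := exists_honest_cert (by omega : 0 < k) G ident hinj hB hG
      exact ⟨cert, fun v => (Nat.cast_le.2 (h1 v)).trans (hs _ hn),
        fun v => decide_eq_true (Or.inr (h2 k v))⟩
  · by_contra! h
    exact hG (inducedFree_of_accepted hk hinj fun v => by simpa using h v)

theorem exists_le_mul_log {f : ℕ → ℕ}
    (hf : (fun n => (f n : ℝ)) =O[atTop] (fun n : ℕ => Real.log n)) :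
    ∃ c : ℝ, 0 < c ∧ ∀ n, 2 ≤ n → (f n : ℝ) ≤ c * Real.log n := by
  obtain ⟨c, hc⟩ := hf.bound
  obtain ⟨N, hN⟩ := eventually_atTop.1 hc
  -- The sum absorbs the finitely many `n < N`; the factor `2` compensates `log n ≥ 1/2`.
  refine ⟨|c| + 2 * ∑ m ∈ Finset.range N, (f m : ℝ) + 1, by positivity, fun n hn => ?_⟩
  have hl : (1 : ℝ) / 2 ≤ Real.log n := by
    have h1 : Real.log 2 ≤ Real.log n := Real.log_le_log (by norm_num) (by exact_mod_cast hn)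
    linarith [Real.log_two_gt_d9]
  have hS : (0 : ℝ) ≤ ∑ m ∈ Finset.range N, (f m : ℝ) := by positivity
  rcases lt_or_ge n N with h | h
  · have h1 : (f n : ℝ) ≤ ∑ m ∈ Finset.range N, (f m : ℝ) :=
      Finset.single_le_sum (f := fun m => (f m : ℝ)) (fun _ _ => by positivity)
        (Finset.mem_range.2 h)
    have h2 := mul_le_mul_of_nonneg_left hl hS
    have h3 : 0 ≤ |c| * Real.log n := by positivity
    nlinarith
  · have h1 := hN n h
    rw [Real.norm_of_nonneg (by positivity), Real.norm_of_nonneg (by linarith)] at h1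
    have h2 : c * Real.log n ≤ |c| * Real.log n :=
      mul_le_mul_of_nonneg_right (le_abs_self c) (by linarith)
    have h3 := mul_nonneg hS (by linarith : 0 ≤ Real.log n)
    nlinarith

theorem natLog_two_le (n : ℕ) (hn : 2 ≤ n) : (Nat.log 2 n : ℝ) ≤ 2 * Real.log n := by
  have h1 : ((2 ^ Nat.log 2 n : ℕ) : ℝ) ≤ n := by
    exact_mod_cast Nat.pow_log_le_self 2 (by omega)
  have h2 := Real.log_le_log (by positivity) h1
  push_cast at h2
  rw [Real.log_pow] at h2
  have := Real.log_two_gt_d9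
  have h3 : (0 : ℝ) ≤ Nat.log 2 n := by positivity
  nlinarith

theorem exists_hasLocalCertification {k : ℕ} (hk : 2 ≤ k) {idBits : ℕ → ℕ}
    (hid : (fun n => (idBits n : ℝ)) =O[atTop] (fun n : ℕ => Real.log n)) :
    ∃ C : ℝ, 0 < C ∧ ∀ s : ℕ → ℝ, (∀ n : ℕ, 2 ≤ n → C * (n * Real.log n ^ 3) ≤ s n) → 0 ≤ s 1 →
      HasLocalCertification idBits k s
        (fun _ G => InducedFree (SimpleGraph.pathGraph (3 * k - 1)) G) := by
  obtain ⟨c, hc, hb⟩ := exists_le_mul_log hid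
  -- Each additive constant is doubled using `1 ≤ 2 log n`, and `Nat.log 2 n + 1 ≤ 4 log n`.
  refine ⟨16 * 4 ^ 2 * (4 * (2 * (c + 2 + 6 * k + 8) + 2)), by positivity,
    fun s hs hs1 => hasLocalCertification_of_le hk (fun n hn => le_trans ?_ (hs n hn)) hs1⟩
  have hl : (1 : ℝ) / 2 ≤ Real.log n := by
    have h1 : Real.log 2 ≤ Real.log n := Real.log_le_log (by norm_num) (by exact_mod_cast hn)
    linarith [Real.log_two_gt_d9]
  have hlog := natLog_two_le n hn
  have hid := hb n hn
  push_cast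
  set L := Real.log n
  have hL : 0 ≤ L := by linarith
  have h1 : (Nat.log 2 n : ℝ) + 1 ≤ 4 * L := by linarith
  have h2 : (4 * (2 * (idBits n + Nat.log 2 n + 3 * k + 4) + 1) : ℝ) ≤
      4 * (2 * (c + 2 + 6 * k + 8) + 2) * L := by
    have : (k : ℝ) ≤ k * (2 * L) := le_mul_of_one_le_right (by positivity) (by linarith)
    nlinarith
  calc (16 * n * (Nat.log 2 n + 1) ^ 2 * (4 * (2 * (idBits n + Nat.log 2 n + 3 * k + 4) + 1)) : ℝ)
      ≤ 16 * n * (4 * L) ^ 2 * (4 * (2 * (c + 2 + 6 * k + 8) + 2) * L) := by gcongr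
    _ = _ := by ring

theorem mul_log_le_rpow {ε : ℝ} {n : ℕ} (hn : 0 < n) :
    n * (ε * Real.log n) ≤ (n : ℝ) ^ (1 + ε) := by
  have hn' : (0 : ℝ) < n := by exact_mod_cast hn
  rw [Real.rpow_add hn', Real.rpow_one]
  refine mul_le_mul_of_nonneg_left ?_ hn'.le
  rw [Real.rpow_def_of_pos hn']
  linarith [Real.add_one_le_exp (Real.log n * ε)]

end LocalCert

theorem mainTheorem3 (k : ℕ) (hk : 2 ≤ k) (idBits : ℕ → ℕ)
    (hid : (fun n => (idBits n : ℝ)) =O[atTop] (fun n : ℕ => Real.log n)) :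
    (∃ c : ℝ, 0 < c ∧ ∀ ε : ℝ, 0 < ε → ε < 1 →
      LocalCert.HasLocalCertification idBits k
        (fun n => c / ε * Real.log n ^ 2 * (n : ℝ) ^ (1 + ε))
        (fun _ G => LocalCert.InducedFree (SimpleGraph.pathGraph (3 * k - 1)) G)) ∧
    (∃ s : ℕ → ℝ, s =O[atTop] (fun n : ℕ => (n : ℝ) * Real.log n ^ 3) ∧
      LocalCert.HasLocalCertification idBits k s
        (fun _ G => LocalCert.InducedFree (SimpleGraph.pathGraph (3 * k - 1)) G)) := by
  obtain ⟨C, hC, h⟩ := LocalCert.exists_hasLocalCertification hk hid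
  refine ⟨⟨C, hC, fun ε hε _ => h _ (fun n hn => ?_) (by simp)⟩,
    fun n => C * (n * Real.log n ^ 3), (isBigO_refl _ _).const_mul_left C,
    h _ (fun n _ => le_rfl) (by simp)⟩
  calc C * (n * Real.log n ^ 3)
      = C / ε * Real.log n ^ 2 * (n * (ε * Real.log n)) := by field_simp
    _ ≤ C / ε * Real.log n ^ 2 * (n : ℝ) ^ (1 + ε) :=
        mul_le_mul_of_nonneg_left (LocalCert.mul_log_le_rpow (by omega)) (by positivity)
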